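/- Let $k\ge 2$ be an integer and let $\chi_1,\chi_2$ be primitive Dirichlet characters of conductors $\mathfrak f_1,\mathfrak f_2\ge 1$ (extended by $0$ to integers not prime to the conductor) such that $\chi_1(-1)\chi_2(-1)=(-1)^k$. Put $N=\mathfrak f_1\mathfrak f_2$ and assume that $N>1$ or $k>2$. For a Dirichlet character $\phi$ modulo $\mathfrak f$ put $W(\phi)=\sum_{n=1}^{\mathfrak f}\phi(n)e^{2\pi i n/\mathfrak f}$ and define $B_{m,\phi}$ by $\sum_{n=1}^{\mathfrak f}\phi(n)\frac{te^{nt}}{e^{\mathfrak f t}-1}=\sum_{m\ge 0}B_{m,\phi}\frac{t^m}{m!}$. For $z$ in the complex upper half-plane let $$E_k^{\chi_1,\chi_2}(z)=-\delta(\chi_1)\frac{B_{k,\chi_2}}{2k}+\sum_{n\ge 1}\Big(\sum_{m\mid n}\chi_1(n/m)\chi_2(m)m^{k-1}\Big)e^{2\pi i n z},$$ where $\delta(\chi_1)=1$ if $\chi_1$ is trivial and $\delta(\chi_1)=0$ otherwise. For an integer $M\ge 1$ let $(\alpha_M f)(z)=f(Mz)$. Denote by $(\chi_1\overline{\chi_2})_0$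 and $(\overline{\chi_1}\chi_2)_0$ the primitive characters attached to $\chi_1\overline{\chi_2}$ and $\overline{\chi_1}\chi_2$, and by $\mathfrak f_0$ their common conductor. Let $\gamma=\begin{pmatrix}u&\beta\\ v&\delta\end{pmatrix}\in\mathrm{SL}_2(\mathbf Z)$ and let $M\ge 1$ be an integer. Put $r=\gcd(v,M)$, $v'=v/r$ and $M'=M/r$. Then the limit $$\Upsilon=\lim_{\mathrm{Im}(z)\to\infty}\big((\alpha_M E_k^{\chi_1,\chi_2})|_k\gamma\big)(z),\qquad (f|_k\gamma)(z)=(vz+\delta)^{-k}f\Big(\frac{uz+\beta}{vz+\delta}\Big),$$ (the constant term at $\infty$ of $(\alpha_M E_k^{\chi_1,\chi_2})|_k\gamma$) exists. If $\mathfrak f_2\nmid v'$, then $\Upsilon=0$. If $\mathfrak f_2\mid v'$, then $$\Upsilon\ne 0\iff\gcd\Big(\frac{v'}{\mathfrak f_2},\mathfrak f_1\Big)=1.$$ Moreover, if $\mathfrak f_2\mid v'$ and $\gcd(v'/\mathfrak f_2,\mathfrak f_1)=1$, then $\Upsilon$ is the non-zero algebraic number $$\Upsilon=\xi\cdot\Big(\frac{\mathfrak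 f_2}{M'\mathfrak f_0}\Big)^k\cdot\frac{W\big((\chi_1\overline{\chi_2})_0\big)}{W(\overline{\chi_2})}\cdot\frac{B_{k,(\overline{\chi_1}\chi_2)_0}}{2k}\prod_{p\mid N}\Big(1-(\chi_1\overline{\chi_2})_0(p)\,p^{-k}\Big),$$ where $\xi=-\chi_2(\delta)\,\overline{\chi_2}(M')\,\chi_1(-v'/\mathfrak f_2)$ is a root of unity and $p$ runs over the prime divisors of $N$. -/

import Mathlib

open scoped MatrixGroups ModularForm

instance DirichletCharacter.neZero_conductor {n : ℕ} [NeZero n] (χ : DirichletCharacter ℂ n) :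
    NeZero χ.conductor := ⟨χ.conductor_ne_zero⟩

instance Nat.neZero_lcm (m n : ℕ) [NeZero m] [NeZero n] : NeZero (Nat.lcm m n) :=
  ⟨Nat.lcm_ne_zero (NeZero.ne m) (NeZero.ne n)⟩

noncomputable section

/-- The Gauss sum `W(φ) = ∑_{n mod f} φ(n) exp(2πi n / f)` of a Dirichlet character modulo `f`. -/
def gaussW {f : ℕ} [NeZero f] (φ : DirichletCharacter ℂ f) : ℂ :=
  gaussSum φ ZMod.stdAddChar

/-- The power series `(exp(f t) - 1) / t`, with constant coefficient `f`. -/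
def expSubOneDivX (f : ℕ) : PowerSeries ℂ :=
  PowerSeries.mk fun j ↦ (f : ℂ) ^ (j + 1) / ((j + 1).factorial : ℂ)

theorem X_mul_expSubOneDivX (f : ℕ) :
    PowerSeries.X * expSubOneDivX f =
      PowerSeries.rescale (f : ℂ) (PowerSeries.exp ℂ) - 1 := by
  ext n
  cases n with
  | zero =>
    rw [map_sub, PowerSeries.coeff_rescale]
    simp
  | succ n =>
    simp [PowerSeries.coeff_succ_X_mul, expSubOneDivX, PowerSeries.coeff_rescale,
      PowerSeries.coeff_exp, PowerSeries.coeff_one, div_eq_mul_inv]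

/-- The formal power series `∑_{n=1}^{f} φ(n) t exp(n t) / (exp(f t) - 1)`. -/
def genBernoulliSeries {f : ℕ} (φ : DirichletCharacter ℂ f) : PowerSeries ℂ :=
  (∑ n ∈ Finset.Icc 1 f,
    PowerSeries.C (φ (n : ZMod f)) * PowerSeries.rescale (n : ℂ) (PowerSeries.exp ℂ)) *
  (expSubOneDivX f)⁻¹

/-- The defining identity of the generating series. -/
theorem genBernoulliSeries_mul {f : ℕ} [NeZero f] (φ : DirichletCharacter ℂ f) :
    genBernoulliSeries φ * (PowerSeries.rescale (f : ℂ) (PowerSeries.exp ℂ) - 1) =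
      ∑ n ∈ Finset.Icc 1 f, PowerSeries.C (φ (n : ZMod f)) *
        (PowerSeries.X * PowerSeries.rescale (n : ℂ) (PowerSeries.exp ℂ)) := by
  have h : PowerSeries.constantCoeff (expSubOneDivX f) ≠ 0 := by
    rw [← PowerSeries.coeff_zero_eq_constantCoeff_apply]
    simp [expSubOneDivX, NeZero.ne f]
  rw [← X_mul_expSubOneDivX, genBernoulliSeries, mul_assoc,
    mul_left_comm _ PowerSeries.X, PowerSeries.inv_mul_cancel _ h, mul_one, Finset.sum_mul]
  exact Finset.sum_congr rfl fun n _ ↦ by ring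

/-- The generalized Bernoulli number `B_{m,φ}`, that is, `m!` times the coefficient of `t ^ m` in
`∑_{n=1}^{f} φ(n) t exp(n t) / (exp(f t) - 1)`. -/
def genBernoulli {f : ℕ} (φ : DirichletCharacter ℂ f) (m : ℕ) : ℂ :=
  (m.factorial : ℂ) * PowerSeries.coeff m (genBernoulliSeries φ)

/-- The twisted divisor sum `∑_{m ∣ n} χ₁(n/m) χ₂(m) m^(k-1)` (used for `k ≥ 2`). -/
def twistedSigma {f₁ f₂ : ℕ} (χ₁ : DirichletCharacter ℂ f₁) (χ₂ : DirichletCharacter ℂ f₂)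
    (k n : ℕ) : ℂ :=
  ∑ m ∈ n.divisors, χ₁ ((n / m : ℕ) : ZMod f₁) * χ₂ (m : ZMod f₂) * (m : ℂ) ^ (k - 1)

open Classical in
/-- The Eisenstein series
`E_k^{χ₁,χ₂}(z) = -δ(χ₁) B_{k,χ₂} / (2k) + ∑_{n ≥ 1} σ_{k-1}^{χ₁,χ₂}(n) exp(2πi n z)`. -/
def eisensteinE {f₁ f₂ : ℕ} (k : ℕ) (χ₁ : DirichletCharacter ℂ f₁)
    (χ₂ : DirichletCharacter ℂ f₂) (z : UpperHalfPlane) : ℂ :=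
  -(if χ₁ = 1 then 1 else 0) * (genBernoulli χ₂ k / (2 * (k : ℂ))) +
    ∑' n : ℕ+, twistedSigma χ₁ χ₂ k n *
      Complex.exp (2 * (Real.pi : ℂ) * Complex.I * ((n : ℕ) : ℂ) * (z : ℂ))

/-- The degeneracy operator `(α_M f)(z) = f(M z)`. -/
def degeneracy (M : ℕ) [NeZero M] (f : UpperHalfPlane → ℂ) (z : UpperHalfPlane) : ℂ :=
  f ⟨(M : ℂ) * (z : ℂ), by
    simpa using mul_pos (Nat.cast_pos.mpr (NeZero.pos M) : (0 : ℝ) < M) z.im_pos⟩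

/-- `(α_M E_k^{χ₁,χ₂}) ∣_k γ` as a function on the upper half-plane. -/
def slashedEisenstein {f₁ f₂ : ℕ} (k : ℕ) (χ₁ : DirichletCharacter ℂ f₁)
    (χ₂ : DirichletCharacter ℂ f₂) (M : ℕ) [NeZero M] (γ : SL(2, ℤ)) : UpperHalfPlane → ℂ :=
  degeneracy M (eisensteinE k χ₁ χ₂) ∣[(k : ℤ)] γ

/-- The constant term `Υ_k^{χ₁,χ₂}(γ, M)`: the limit of `(α_M E_k^{χ₁,χ₂}) ∣_k γ` as
`Im z → ∞`. -/
def Upsilon {f₁ f₂ : ℕ} (k : ℕ) (χ₁ : DirichletCharacter ℂ f₁)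
    (χ₂ : DirichletCharacter ℂ f₂) (γ : SL(2, ℤ)) (M : ℕ) [NeZero M] : ℂ :=
  UpperHalfPlane.valueAtInfty (slashedEisenstein k χ₁ χ₂ M γ)

end

/-! Up to a non-zero scalar, `E_k^{χ₁,χ₂}(z)` is a lattice sum of `(mz+n)^(-k)` with coefficient
`χ₁(m/f₂) χ₂⁻¹(n)`, supported on `f₂ ∣ m` and depending only on `(m, n)` modulo `N = f₁f₂`
(`weightedLatticeSum_eisensteinCoeff`). Row by row this is Lipschitz's formula; the sum over
residues modulo `f₂` gives the Gauss sum of `χ₂⁻¹`.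

Slashing by `γ` only permutes the classes modulo `N`, by right multiplication
(`weightedLatticeSum_smul`). At infinity every row with `m ≠ 0` decays, so the limit is the sum over
the vectors `(0, t)` with coefficients read at `(0, t)γ⁻¹ = (-tv, tu)`. It vanishes unless `f₂ ∣ v`,
and is then a multiple of `χ₁(-v/f₂) χ₂⁻¹(u) ∑ χ₁χ₂⁻¹(t) t^(-k)`. In weight two the double series is
not absolutely convergent. There `N > 1` makes the coefficients sum to zero, so the sum over the
class of `0` can be subtracted from every class without changing the total, which restores absolute
convergence.

The operator `α_M` is absorbed by factoring `diag(M,1)γ` as an element of `SL₂(ℤ)` with first column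
`(M'u, v')` times an upper triangular matrix (`exists_degeneracy_slash_eq`).

The remaining series is twice an `L`-value at `k`, times Euler factors at the primes dividing `N`.
It is non-zero because the Euler product converges, and the Fourier series of Bernoulli polynomials
evaluates it (`LSeries_eq_genBernoulli`). So only `χ₁(-v'/f₂)` decides whether the constant term
vanishes. -/

/-! ### Gauss sums, generalized Bernoulli numbers and `L`-values. -/

open Complex in
theorem gaussW_mul_gaussW_inv {f : ℕ} [NeZero f] {φ : DirichletCharacter ℂ f}
    (hφ : φ.IsPrimitive) : gaussW φ * gaussW φ⁻¹ = φ (-1) * f := by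
  classical
  -- Primitivity gives this also at non-units, where both sides vanish; hence `a` can later range
  -- over all residues.
  have h : ∀ a : ZMod f, φ⁻¹ a * gaussW φ = ∑ b, φ b * ZMod.stdAddChar (a * b) := fun a ↦ by
    rw [gaussW, ← gaussSum_mulShift_of_isPrimitive _ hφ a]
    simp [gaussSum, AddChar.mulShift_apply]
  calc gaussW φ * gaussW φ⁻¹
      = ∑ a, (φ⁻¹ a * gaussW φ) * ZMod.stdAddChar a := by
        rw [mul_comm, gaussW, gaussSum, Finset.sum_mul]
        exact Finset.sum_congr rfl fun a _ ↦ by ring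
    _ = ∑ b, φ b * ∑ a : ZMod f, ZMod.stdAddChar (a * (b + 1)) := by
        simp_rw [h, Finset.sum_mul, Finset.mul_sum]
        rw [Finset.sum_comm]
        refine Finset.sum_congr rfl fun b _ ↦ Finset.sum_congr rfl fun a _ ↦ ?_
        rw [mul_add, mul_one, AddChar.map_add_eq_mul, mul_assoc]
    _ = φ (-1) * f := by
        -- Orthogonality of additive characters leaves only `b = -1`.
        simp_rw [AddChar.sum_mulShift _ (ZMod.isPrimitive_stdAddChar f)]
        rw [Finset.sum_eq_single (-1)]
        · simp
        · intro b _ hb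
          rw [if_neg (fun h ↦ hb (eq_neg_of_add_eq_zero_left h))]
          simp
        · simp

theorem DirichletCharacter.isPrimitive_inv {f : ℕ} {φ : DirichletCharacter ℂ f}
    (hφ : φ.IsPrimitive) : φ⁻¹.IsPrimitive := by
  rw [DirichletCharacter.isPrimitive_def, DirichletCharacter.conductor_inv]
  exact hφ

theorem DirichletCharacter.apply_neg_one_ne_zero {f : ℕ} (φ : DirichletCharacter ℂ f) :
    φ (-1) ≠ 0 := by
  rcases φ.even_or_odd with h | h
  · rw [h]; exact one_ne_zero
  · rw [h]; norm_num

theorem gaussW_ne_zero {f : ℕ} [NeZero f] {φ : DirichletCharacter ℂ f}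
    (hφ : φ.IsPrimitive) : gaussW φ ≠ 0 :=
  left_ne_zero_of_mul (gaussW_mul_gaussW_inv hφ ▸
    mul_ne_zero φ.apply_neg_one_ne_zero (Nat.cast_ne_zero.mpr (NeZero.ne f)))

theorem ZMod.sum_Icc_natCast {f : ℕ} [NeZero f] {A : Type*} [AddCommMonoid A] (g : ZMod f → A) :
    ∑ n ∈ Finset.Icc 1 f, g (n : ZMod f) = ∑ a, g a := by
  have hf := NeZero.pos f
  refine Finset.sum_nbij (fun n : ℕ ↦ (n : ZMod f)) (by simp) ?_ ?_ (by simp)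
  · intro a ha b hb hab
    simp only [Finset.coe_Icc, Set.mem_Icc] at ha hb
    have h := (ZMod.intCast_eq_intCast_iff_dvd_sub a b f).mp (by exact_mod_cast hab)
    obtain ⟨c, hc⟩ := h
    have h1 : c < 1 := by nlinarith
    have h2 : -1 < c := by nlinarith
    have : c = 0 := by omega
    subst this
    omega
  · intro a _
    by_cases ha : a = 0
    · exact ⟨f, by simp; omega, by simp [ha]⟩
    · refine ⟨a.val, ?_, by simp⟩
      have := (ZMod.val_ne_zero a).mpr ha
      have := a.val_lt
      simp only [Finset.coe_Icc, Set.mem_Icc]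
      omega

-- This is the generating function of the Bernoulli polynomials at `n / f` with `t` replaced by `f
-- t`, after cancelling one factor `X`.
open PowerSeries in
theorem rescale_exp_mul_expSubOneDivX_inv {f : ℕ} (hf : f ≠ 0) (n : ℕ) :
    rescale (n : ℂ) (exp ℂ) * (expSubOneDivX f)⁻¹ =
      C (f : ℂ)⁻¹ * rescale (f : ℂ) (mk fun j ↦
        Polynomial.aeval ((n : ℂ) / f) ((1 / (j.factorial : ℚ) : ℚ) • Polynomial.bernoulli j)) := by
  have hf' : (f : ℂ) ≠ 0 := Nat.cast_ne_zero.mpr hf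
  have h : constantCoeff (expSubOneDivX f) ≠ 0 := by
    rw [← coeff_zero_eq_constantCoeff_apply]
    simp [expSubOneDivX, hf]
  have key := congrArg (rescale (f : ℂ)) (Polynomial.bernoulli_generating_function ((n : ℂ) / f))
  rw [map_mul, map_sub, map_one, map_mul, rescale_rescale, div_mul_cancel₀ _ hf', rescale_X,
    ← X_mul_expSubOneDivX, mul_left_comm, mul_comm (C (f : ℂ)), mul_assoc] at key
  have key := mul_left_cancel₀ X_ne_zero key
  rw [eq_comm, PowerSeries.eq_mul_inv_iff_mul_eq h, mul_assoc, key, ← mul_assoc, ← map_mul,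
    inv_mul_cancel₀ hf', map_one, one_mul]

theorem genBernoulli_eq_sum {f : ℕ} [NeZero f] (φ : DirichletCharacter ℂ f) (k : ℕ) :
    genBernoulli φ k = (f : ℂ) ^ k / f * ∑ n ∈ Finset.Icc 1 f,
      φ (n : ZMod f) * (bernoulliFun k ((n : ℝ) / f) : ℂ) := by
  have h (n : ℕ) : (bernoulliFun k ((n : ℝ) / f) : ℂ) =
      Polynomial.aeval ((n : ℂ) / f) (Polynomial.bernoulli k) := by
    rw [bernoulliFun, Polynomial.eval_map_algebraMap, ← Complex.coe_algebraMap,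
      ← Polynomial.aeval_algebraMap_apply]
    simp
  rw [genBernoulli, genBernoulliSeries, Finset.sum_mul, map_sum, Finset.mul_sum, Finset.mul_sum]
  refine Finset.sum_congr rfl fun n _ ↦ ?_
  rw [mul_assoc, rescale_exp_mul_expSubOneDivX_inv (NeZero.ne f), PowerSeries.coeff_C_mul,
    PowerSeries.coeff_C_mul, PowerSeries.coeff_rescale, PowerSeries.coeff_mk, h, map_smul,
    Algebra.smul_def]
  have : (k.factorial : ℂ) ≠ 0 := Nat.cast_ne_zero.mpr k.factorial_ne_zero
  simp
  field_simp

-- The Fourier series of the Bernoulli function at the points `a / f` is averaged against `ψ⁻¹`;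
-- primitivity turns the coefficient of index `n` into `ψ(n) W(ψ⁻¹)`. Parity then gives `W(ψ) W(ψ⁻¹)
-- = (-1)^k f`, which moves the Gauss sum from the denominator to the numerator. The term `n = 0` is
-- zero because `0⁻¹ = 0`.
open Complex in
theorem hasSum_character_div_pow {f : ℕ} [NeZero f] {ψ : DirichletCharacter ℂ f}
    (hψ : ψ.IsPrimitive) {k : ℕ} (hk : 2 ≤ k) (hpar : ψ (-1) = (-1) ^ k) :
    HasSum (fun n : ℤ ↦ ψ (n : ZMod f) * ((n : ℂ) ^ k)⁻¹)
      (-((-2 * Real.pi * I) ^ k / k.factorial) * ((f : ℂ) ^ k)⁻¹ * gaussW ψ *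
        genBernoulli ψ⁻¹ k) := by
  have hf : (f : ℂ) ≠ 0 := Nat.cast_ne_zero.mpr (NeZero.ne f)
  have hW' := gaussW_ne_zero (DirichletCharacter.isPrimitive_inv hψ)
  have h1 : HasSum (fun n : ℤ ↦ ∑ a ∈ Finset.Icc 1 f, ψ⁻¹ (a : ZMod f) *
      (1 / (n : ℂ) ^ k * fourier n (((a : ℝ) / f : ℝ) : UnitAddCircle)))
      (∑ a ∈ Finset.Icc 1 f, ψ⁻¹ (a : ZMod f) *
        (-(2 * Real.pi * I) ^ k / k.factorial * bernoulliFun k ((a : ℝ) / f))) := by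
    refine hasSum_sum fun a ha ↦ HasSum.mul_left _ ?_
    refine hasSum_one_div_pow_mul_fourier_mul_bernoulliFun hk ⟨by positivity, ?_⟩
    exact div_le_one_of_le₀ (by exact_mod_cast (Finset.mem_Icc.mp ha).2) (by positivity)
  have h2 : ∀ n : ℤ, ∑ a ∈ Finset.Icc 1 f, ψ⁻¹ (a : ZMod f) *
      (1 / (n : ℂ) ^ k * fourier n (((a : ℝ) / f : ℝ) : UnitAddCircle)) =
      gaussW ψ⁻¹ * (ψ (n : ZMod f) * ((n : ℂ) ^ k)⁻¹) := by
    intro n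
    have h3 : ψ (n : ZMod f) * gaussW ψ⁻¹ =
        ∑ b : ZMod f, ψ⁻¹ b * ZMod.stdAddChar ((n : ZMod f) * b) := by
      have := gaussSum_mulShift_of_isPrimitive (ZMod.stdAddChar (N := f))
        (DirichletCharacter.isPrimitive_inv hψ) (n : ZMod f)
      rw [inv_inv] at this
      rw [gaussW, ← this]
      simp [gaussSum, AddChar.mulShift_apply]
    rw [← mul_assoc, mul_comm (gaussW _), h3, ← ZMod.sum_Icc_natCast, Finset.sum_mul]
    refine Finset.sum_congr rfl fun a _ ↦ ?_
    have : (n : ZMod f) * (a : ZMod f) = ((n * a : ℤ) : ZMod f) := by push_cast; rfl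
    rw [this, ZMod.stdAddChar_coe, fourier_coe_apply, one_div]
    push_cast
    rw [mul_assoc (ψ⁻¹ _), mul_comm (((n : ℂ) ^ k)⁻¹)]
    have e : 2 * Real.pi * I * n * ((a : ℂ) / f) / 1 = 2 * Real.pi * I * (n * a) / f := by ring
    simp only [e]
  simp_rw [h2] at h1
  have h4 := h1.mul_left (gaussW ψ⁻¹)⁻¹
  simp_rw [inv_mul_cancel_left₀ hW'] at h4
  refine (congrArg (HasSum _) ?_).mp h4
  have hW := gaussW_mul_gaussW_inv hψ
  rw [hpar] at hW
  rw [genBernoulli_eq_sum, inv_mul_eq_iff_eq_mul₀ hW']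
  simp_rw [mul_left_comm (ψ⁻¹ _)]
  rw [← Finset.mul_sum]
  have e : (-2 * Real.pi * I : ℂ) ^ k = (-1) ^ k * (2 * Real.pi * I) ^ k := by
    rw [← mul_pow]; ring
  have e2 : ((-1 : ℂ) ^ k) * (-1) ^ k = 1 := by rw [← mul_pow]; simp
  set S := ∑ n ∈ Finset.Icc 1 f, ψ⁻¹ (n : ZMod f) * (bernoulliFun k ((n : ℝ) / f) : ℂ)
  rw [e]
  have e3 : gaussW ψ⁻¹ * (-((-1) ^ k * (2 * Real.pi * I) ^ k / k.factorial) * ((f : ℂ) ^ k)⁻¹ *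
      gaussW ψ * ((f : ℂ) ^ k / f * S)) = -(2 * Real.pi * I) ^ k / k.factorial * S *
      ((-1) ^ k * (gaussW ψ * gaussW ψ⁻¹) * (((f : ℂ) ^ k)⁻¹ * (f : ℂ) ^ k) * (f : ℂ)⁻¹) := by
    ring
  have e4 : (-1 : ℂ) ^ k * ((-1) ^ k * f) * 1 * (f : ℂ)⁻¹ = 1 := by
    rw [← mul_assoc, e2, one_mul, mul_one, mul_inv_cancel₀ hf]
  rw [e3, hW, inv_mul_cancel₀ (pow_ne_zero k hf), e4, mul_one]

theorem hasSum_int_character_div_pow {f : ℕ} (φ : DirichletCharacter ℂ f) {k : ℕ} (hk : 2 ≤ k)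
    (hpar : φ (-1) = (-1) ^ k) :
    HasSum (fun n : ℤ ↦ φ (n : ZMod f) * ((n : ℂ) ^ k)⁻¹)
      (2 * LSeries (fun n ↦ φ (n : ZMod f)) k) := by
  have hk0 : k ≠ 0 := by omega
  have hs : 1 < (k : ℂ).re := by simpa using! (by exact_mod_cast hk : (1 : ℝ) < k)
  have h : HasSum (fun n : ℕ ↦ φ (n : ZMod f) * ((n : ℂ) ^ k)⁻¹)
      (LSeries (fun n ↦ φ (n : ZMod f)) k) := by
    refine (congrArg (HasSum · _) (funext fun n ↦ ?_)).mp
      (DirichletCharacter.LSeriesSummable_of_one_lt_re φ hs).LSeriesHasSum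
    rcases eq_or_ne n 0 with rfl | hn
    · simp [hk0]
    · simp [LSeries.term_of_ne_zero hn, div_eq_mul_inv]
  have h' : HasSum (fun n : ℕ ↦ φ ((-(n : ℤ) : ℤ) : ZMod f) * (((-(n : ℤ) : ℤ) : ℂ) ^ k)⁻¹)
      (LSeries (fun n ↦ φ (n : ZMod f)) k) := by
    refine (congrArg (HasSum · _) (funext fun n ↦ ?_)).mp h
    have e : ((-1 : ℂ) ^ k) * ((-1) ^ k)⁻¹ = 1 := mul_inv_cancel₀ (by simp)
    have e1 : ((-(n : ℤ) : ℤ) : ZMod f) = -1 * n := by push_cast; ring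
    have e2 : ((-(n : ℤ) : ℤ) : ℂ) = -1 * n := by push_cast; ring
    rw [e1, e2, map_mul, mul_pow, mul_inv, hpar]
    linear_combination (-φ n * ((n : ℂ) ^ k)⁻¹) * e
  have := HasSum.of_nat_of_neg (f := fun n : ℤ ↦ φ (n : ZMod f) * ((n : ℂ) ^ k)⁻¹)
    (by simpa using h) h'
  simpa [hk0, two_mul] using this

/-- The value at `k` of the `L`-series of a primitive character, in terms of the generalized
Bernoulli number of its inverse. -/
theorem LSeries_eq_genBernoulli {f : ℕ} [NeZero f] {ψ : DirichletCharacter ℂ f}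
    (hψ : ψ.IsPrimitive) {k : ℕ} (hk : 2 ≤ k) (hpar : ψ (-1) = (-1) ^ k) :
    2 * LSeries (fun n ↦ ψ (n : ZMod f)) k =
      -((-2 * Real.pi * Complex.I) ^ k / k.factorial) * ((f : ℂ) ^ k)⁻¹ * gaussW ψ *
        genBernoulli ψ⁻¹ k :=
  (hasSum_int_character_div_pow ψ hk hpar).unique (hasSum_character_div_pow hψ hk hpar)

theorem one_sub_character_mul_ne_zero {f : ℕ} (φ : DirichletCharacter ℂ f) {k p : ℕ}
    (hk : k ≠ 0) (hp : p.Prime) : 1 - φ (p : ZMod f) * ((p : ℂ) ^ k)⁻¹ ≠ 0 := by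
  intro h
  have h1 : ‖φ (p : ZMod f) * ((p : ℂ) ^ k)⁻¹‖ = 1 := by
    rw [← sub_eq_zero.mp h, norm_one]
  have h2 : 1 < (p : ℝ) ^ k := one_lt_pow₀ (by exact_mod_cast hp.one_lt) hk
  rw [norm_mul, norm_inv, norm_pow, Complex.norm_natCast] at h1
  have h3 : ((p : ℝ) ^ k)⁻¹ < 1 := inv_lt_one_of_one_lt₀ h2
  have h4 := DirichletCharacter.norm_le_one φ (p : ZMod f)
  have h5 : 0 < ((p : ℝ) ^ k)⁻¹ := by positivity
  nlinarith

theorem LSeries_changeLevel_natCast {m n : ℕ} [NeZero m] [NeZero n] (hmn : m ∣ n)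
    (φ : DirichletCharacter ℂ m) {k : ℕ} (hk : 2 ≤ k) :
    LSeries (fun j ↦ DirichletCharacter.changeLevel hmn φ (j : ZMod n)) k =
      LSeries (fun j ↦ φ (j : ZMod m)) k *
        ∏ p ∈ n.primeFactors, (1 - φ (p : ZMod m) * ((p : ℂ) ^ k)⁻¹) := by
  have hs : 1 < (k : ℂ).re := by simpa using! (by exact_mod_cast hk : (1 : ℝ) < k)
  have := DirichletCharacter.LFunction_changeLevel hmn φ (s := k) (Or.inr (by
    intro h; rw [h] at hs; simp at hs))
  rw [DirichletCharacter.LFunction_eq_LSeries _ hs, DirichletCharacter.LFunction_eq_LSeries _ hs]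
    at this
  simpa [Complex.cpow_neg] using this

/-- Serves to compare characters whose levels are conductors that are equal only propositionally. -/
theorem genBernoulli_congr {f g : ℕ} (φ : DirichletCharacter ℂ f) (ψ : DirichletCharacter ℂ g)
    (hfg : f = g) (h : ∀ n : ℕ, φ (n : ZMod f) = ψ (n : ZMod g)) (k : ℕ) :
    genBernoulli φ k = genBernoulli ψ k := by
  subst hfg
  simp only [genBernoulli, genBernoulliSeries, h]

/-! ### Algebraicity of character values, Gauss sums and Bernoulli numbers. -/

theorem isAlgebraic_of_pow_eq_one {x : ℂ} {n : ℕ} (hn : 0 < n) (h : x ^ n = 1) :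
    IsAlgebraic ℚ x :=
  IsAlgebraic.of_pow hn (h ▸ isAlgebraic_one)

theorem isAlgebraic_character {f : ℕ} [NeZero f] (φ : DirichletCharacter ℂ f) (a : ZMod f) :
    IsAlgebraic ℚ (φ a) := by
  by_cases ha : IsUnit a
  · refine isAlgebraic_of_pow_eq_one (Fintype.card_pos (α := (ZMod f)ˣ)) ?_
    obtain ⟨u, rfl⟩ := ha
    rw [← map_pow, ← Units.val_pow_eq_pow_val, pow_card_eq_one, Units.val_one, map_one]
  · rw [φ.map_nonunit ha]
    exact isAlgebraic_zero

theorem isAlgebraic_sum {ι : Type*} {s : Finset ι} {g : ι → ℂ}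
    (h : ∀ i ∈ s, IsAlgebraic ℚ (g i)) : IsAlgebraic ℚ (∑ i ∈ s, g i) :=
  mem_algebraicClosure_iff.mp <| sum_mem fun i hi ↦ mem_algebraicClosure_iff.mpr (h i hi)

theorem isAlgebraic_gaussW {f : ℕ} [NeZero f] (φ : DirichletCharacter ℂ f) :
    IsAlgebraic ℚ (gaussW φ) := by
  refine isAlgebraic_sum fun a _ ↦ (isAlgebraic_character φ a).mul
    (isAlgebraic_of_pow_eq_one (NeZero.pos f) ?_)
  rw [← AddChar.map_nsmul_eq_pow]
  simp

theorem isAlgebraic_genBernoulli {f : ℕ} [NeZero f] (φ : DirichletCharacter ℂ f) (k : ℕ) :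
    IsAlgebraic ℚ (genBernoulli φ k) := by
  rw [genBernoulli_eq_sum]
  refine (((isAlgebraic_natCast f).pow k).mul (isAlgebraic_natCast f).inv).mul
    (isAlgebraic_sum fun n _ ↦ (isAlgebraic_character φ _).mul ?_)
  have : (bernoulliFun k ((n : ℝ) / f) : ℂ) =
      algebraMap ℚ ℂ ((Polynomial.bernoulli k).eval ((n : ℚ) / f)) := by
    have h : (n : ℝ) / f = algebraMap ℚ ℝ ((n : ℚ) / f) := by simp
    rw [bernoulliFun, h, Polynomial.eval_map_apply]
    simp
  rw [this]
  exact isAlgebraic_algebraMap _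

/-! ### Row sums, lattice sums over residue classes, and their limits at infinity. -/

/-- The division-with-remainder bijection `(j, m) ↦ N m + j`. -/
noncomputable def ZMod.prodIntEquiv (N : ℕ) [NeZero N] : ZMod N × ℤ ≃ ℤ :=
  Equiv.ofBijective (fun p ↦ N * p.2 + (p.1.cast : ℤ)) <| by
    refine ⟨fun p q h ↦ ?_, fun a ↦ ⟨((a : ZMod N), a / N), ?_⟩⟩
    · have h1 : p.1 = q.1 := by simpa using congrArg (Int.cast : ℤ → ZMod N) h
      refine Prod.ext h1 ?_
      simpa [h1, NeZero.ne N] using h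
    · simp only [ZMod.coe_intCast]
      exact Int.mul_ediv_add_emod a N

theorem Int.sum_tsum_residue_classes {F : ℤ → ℂ} (hF : Summable F) (N : ℕ) [NeZero N] :
    ∑ j : ZMod N, ∑' m : ℤ, F (N * m + (j.cast : ℤ)) = ∑' m, F m := by
  rw [← (ZMod.prodIntEquiv N).tsum_eq F, Summable.tsum_prod, tsum_fintype]
  · rfl
  · exact (ZMod.prodIntEquiv N).summable_iff.mpr hF

noncomputable section

/-- The sum of `(w + c) ^ (-k)` over the integers `c` congruent to `b` modulo `N`. -/
def inversePowerSum (k N : ℕ) (w : ℂ) (b : ℤ) : ℂ :=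
  ∑' n : ℤ, ((w + ((N * n + b : ℤ) : ℂ)) ^ k)⁻¹

theorem mul_add_injective (N : ℕ) [NeZero N] (b : ℤ) :
    Function.Injective fun n : ℤ ↦ (N : ℤ) * n + b := fun m n h ↦ by
  simpa [NeZero.ne N] using h

theorem summable_inv_add_pow {k : ℕ} (hk : 2 ≤ k) (w : ℂ) :
    Summable fun n : ℤ ↦ ((w + n) ^ k)⁻¹ := by
  have h := EisensteinSeries.linear_right_summable w 1 (k := k) (by exact_mod_cast hk)
  simpa using h

theorem summable_inversePowerSum {k : ℕ} (hk : 2 ≤ k) (N : ℕ) [NeZero N] (w : ℂ) (b : ℤ) :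
    Summable fun n : ℤ ↦ ((w + ((N * n + b : ℤ) : ℂ)) ^ k)⁻¹ :=
  (summable_inv_add_pow hk w).comp_injective (mul_add_injective N b)

theorem inversePowerSum_add_mul (k N : ℕ) (w : ℂ) (b j : ℤ) :
    inversePowerSum k N w (b + N * j) = inversePowerSum k N w b := by
  rw [inversePowerSum, ← (Equiv.addRight (-j)).tsum_eq, inversePowerSum]
  refine tsum_congr fun n ↦ ?_
  simp only [Equiv.coe_addRight]
  congr 4
  ring

theorem inversePowerSum_neg (k N : ℕ) (w : ℂ) (b : ℤ) :
    inversePowerSum k N (-w) (-b) = (-1) ^ k * inversePowerSum k N w b := by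
  rw [inversePowerSum, ← (Equiv.neg ℤ).tsum_eq, inversePowerSum, ← tsum_mul_left]
  refine tsum_congr fun n ↦ ?_
  have : (-w + ((N * (Equiv.neg ℤ) n + -b : ℤ) : ℂ)) = -1 * (w + ((N * n + b : ℤ) : ℂ)) := by
    simp only [Equiv.neg_apply]; push_cast; ring
  rw [this, mul_pow, mul_inv, ← inv_pow, inv_neg_one]

-- Lipschitz's formula at the point `(w + b) / N`, once `N` is pulled out of every term.
open Complex in
theorem inversePowerSum_eq_tsum_exp {k : ℕ} (hk : 2 ≤ k) (N : ℕ) [NeZero N] {w : ℂ}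
    (hw : 0 < w.im) (b : ℤ) :
    inversePowerSum k N w b = ((N : ℂ) ^ k)⁻¹ * ((-2 * Real.pi * I) ^ k / (k - 1).factorial) *
      ∑' l : ℕ+, (l : ℂ) ^ (k - 1) * cexp (2 * Real.pi * I * ((w + b) / N)) ^ (l : ℕ) := by
  have hN : (N : ℂ) ≠ 0 := Nat.cast_ne_zero.mpr (NeZero.ne N)
  have him : 0 < ((w + b) / N).im := by
    have : ((w + b) / N).im = w.im / N := by
      rw [← ofReal_natCast, div_ofReal_im]; simp
    rw [this]
    exact div_pos hw (Nat.cast_pos.mpr (NeZero.pos N))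
  have h := EisensteinSeries.qExpansion_identity_pnat (k := k - 1) (by omega) ⟨_, him⟩
  rw [show k - 1 + 1 = k by omega] at h
  rw [mul_assoc, ← h, inversePowerSum, ← tsum_mul_left]
  refine tsum_congr fun n ↦ ?_
  rw [one_div, ← mul_inv, ← mul_pow]
  congr 2
  push_cast
  field_simp
  ring

/-- The majorant `∑_{l ≥ 1} l ^ (k - 1) r ^ (j l)` of the tails of Eisenstein series. -/
def qMajorant (k : ℕ) (r : ℝ) (j : ℕ) : ℝ := ∑' l : ℕ+, (l : ℝ) ^ (k - 1) * r ^ (j * l : ℕ)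

theorem summable_qMajorant_prod (k : ℕ) {r : ℝ} (hr0 : 0 ≤ r) (hr : r < 1) :
    Summable fun c : ℕ+ × ℕ+ ↦ (c.2 : ℝ) ^ (k - 1) * r ^ (c.1 * c.2 : ℕ) :=
  summable_prod_mul_pow (k - 1) (by rwa [Real.norm_of_nonneg hr0])

theorem summable_qMajorant_term (k : ℕ) {r : ℝ} (hr0 : 0 ≤ r) (hr : r < 1) (j : ℕ+) :
    Summable fun l : ℕ+ ↦ (l : ℝ) ^ (k - 1) * r ^ (j * l : ℕ) :=
  (summable_qMajorant_prod k hr0 hr).prod_factor j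

theorem summable_qMajorant (k : ℕ) {r : ℝ} (hr0 : 0 ≤ r) (hr : r < 1) :
    Summable (qMajorant k r) := by
  rw [← summable_pnat_iff_summable_nat]
  exact (summable_qMajorant_prod k hr0 hr).prod

theorem summable_qMajorant_natAbs (k : ℕ) {r : ℝ} (hr0 : 0 ≤ r) (hr : r < 1) :
    Summable fun m : ℤ ↦ qMajorant k r m.natAbs :=
  summable_int_iff_summable_nat_and_neg.mpr (by simpa using summable_qMajorant k hr0 hr)

theorem qMajorant_nonneg (k : ℕ) {r : ℝ} (hr0 : 0 ≤ r) (j : ℕ) : 0 ≤ qMajorant k r j :=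
  tsum_nonneg fun _ ↦ by positivity

/-- Every exponent `j * l` is at least one, so a factor `r / s` comes out of each term. This yields
both decay as `r → 0` and domination by the series at a fixed `s`. -/
theorem qMajorant_le (k : ℕ) {r s : ℝ} (hr0 : 0 ≤ r) (hrs : r ≤ s) (hs0 : 0 < s) (hs : s < 1)
    (j : ℕ+) : qMajorant k r j ≤ r / s * qMajorant k s j := by
  rw [qMajorant, qMajorant, ← tsum_mul_left]
  refine (summable_qMajorant_term k hr0 (hrs.trans_lt hs) j).tsum_le_tsum (fun l ↦ ?_)
    ((summable_qMajorant_term k hs0.le hs j).mul_left _)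
  have hpos : 0 < (j * l : ℕ) := Nat.mul_pos j.pos l.pos
  obtain ⟨n, hn⟩ := Nat.exists_eq_succ_of_ne_zero hpos.ne'
  rw [hn, pow_succ, pow_succ]
  have : r ^ n ≤ s ^ n := pow_le_pow_left₀ hr0 hrs n
  calc (l : ℝ) ^ (k - 1) * (r ^ n * r) ≤ (l : ℝ) ^ (k - 1) * (s ^ n * r) := by gcongr
    _ = r / s * ((l : ℝ) ^ (k - 1) * (s ^ n * s)) := by field_simp

/-- The norm of `exp(2πi z / N)`. -/
def qNorm (N : ℕ) (z : UpperHalfPlane) : ℝ := Real.exp (-(2 * Real.pi * z.im / N))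

theorem qNorm_pos (N : ℕ) (z : UpperHalfPlane) : 0 < qNorm N z := Real.exp_pos _

theorem qNorm_lt_one (N : ℕ) [NeZero N] (z : UpperHalfPlane) : qNorm N z < 1 := by
  have := z.im_pos
  have := Real.pi_pos
  have : (0 : ℝ) < N := Nat.cast_pos.mpr (NeZero.pos N)
  rw [qNorm, Real.exp_lt_one_iff, neg_lt_zero]
  positivity

theorem tendsto_qNorm (N : ℕ) [NeZero N] :
    Filter.Tendsto (qNorm N) UpperHalfPlane.atImInfty (nhds 0) := by
  have : (0 : ℝ) < N := Nat.cast_pos.mpr (NeZero.pos N)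
  refine Real.tendsto_exp_neg_atTop_nhds_zero.comp ?_
  refine Filter.Tendsto.atTop_div_const this ?_
  exact Filter.Tendsto.const_mul_atTop (by positivity) Filter.tendsto_comap

/-- The constant in the bound for `inversePowerSum`. -/
def rowConst (k N : ℕ) : ℝ :=
  ‖((N : ℂ) ^ k)⁻¹ * ((-2 * Real.pi * Complex.I) ^ k / (k - 1).factorial)‖

-- The shift `b` changes each term of the exponential series only by a phase, so the bound does not
-- depend on it.
open Complex in
theorem norm_inversePowerSum_le_of_pos {k : ℕ} (hk : 2 ≤ k) (N : ℕ) [NeZero N]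
    (z : UpperHalfPlane) (m : ℕ+) (b : ℤ) :
    ‖inversePowerSum k N (m * z) b‖ ≤ rowConst k N * qMajorant k (qNorm N z) m := by
  have hw : 0 < ((m : ℂ) * z).im := by
    have := z.im_pos
    have : (0 : ℝ) < (m : ℕ) := Nat.cast_pos.mpr m.pos
    simpa using by positivity
  rw [inversePowerSum_eq_tsum_exp hk N hw, norm_mul]
  refine mul_le_mul_of_nonneg_left ?_ (norm_nonneg _)
  have hn (l : ℕ+) : ‖(l : ℂ) ^ (k - 1) *
      cexp (2 * Real.pi * I * ((m * z + b) / N)) ^ (l : ℕ)‖ =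
      (l : ℝ) ^ (k - 1) * qNorm N z ^ (m * l : ℕ) := by
    rw [norm_mul, norm_pow, norm_pow, norm_natCast, norm_exp, qNorm, ← Real.exp_nat_mul,
      ← Real.exp_nat_mul]
    congr 2
    have : (2 * Real.pi * I * ((m * (z : ℂ) + b) / N)) =
      ((2 * Real.pi / N : ℝ) : ℂ) * (((m : ℕ) : ℂ) * z + b) * I := by push_cast; ring
    rw [this, mul_I_re, im_ofReal_mul, add_im, ← ofReal_natCast, im_ofReal_mul, intCast_im,
      UpperHalfPlane.coe_im]
    push_cast
    ring
  have hsum := summable_qMajorant_term k (qNorm_pos N z).le (qNorm_lt_one N z) m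
  simp_rw [← hn] at hsum
  exact (norm_tsum_le_tsum_norm hsum).trans_eq (tsum_congr hn)

theorem norm_inversePowerSum_le {k : ℕ} (hk : 2 ≤ k) (N : ℕ) [NeZero N]
    (z : UpperHalfPlane) {m : ℤ} (hm : m ≠ 0) (b : ℤ) :
    ‖inversePowerSum k N (m * z) b‖ ≤ rowConst k N * qMajorant k (qNorm N z) m.natAbs := by
  have hpos : 0 < m.natAbs := Int.natAbs_pos.mpr hm
  rcases Int.natAbs_eq m with h | h
  · have := norm_inversePowerSum_le_of_pos hk N z ⟨m.natAbs, hpos⟩ b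
    have e : (m : ℂ) * z = (m.natAbs : ℂ) * z := by
      conv_lhs => rw [h]
      rw [Int.cast_natCast]
    rw [e]
    exact this
  · have := norm_inversePowerSum_le_of_pos hk N z ⟨m.natAbs, hpos⟩ (-b)
    have e : (m : ℂ) * z = -((m.natAbs : ℂ) * z) := by
      conv_lhs => rw [h]
      rw [Int.cast_neg, Int.cast_natCast, neg_mul]
    rw [e, ← neg_neg b, inversePowerSum_neg, norm_mul, norm_pow, norm_neg, norm_one, one_pow,
      one_mul]
    exact this

theorem summable_rows {k : ℕ} (hk : 2 ≤ k) (N : ℕ) [NeZero N] (z : UpperHalfPlane) (b : ℤ) :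
    Summable fun m : ℤ ↦ inversePowerSum k N (m * z) b := by
  refine Summable.of_norm_bounded_eventually (g := fun m : ℤ ↦
    rowConst k N * qMajorant k (qNorm N z) m.natAbs)
    ((summable_qMajorant_natAbs k (qNorm_pos N z).le (qNorm_lt_one N z)).mul_left _) ?_
  rw [Filter.eventually_cofinite]
  refine (Set.finite_singleton (0 : ℤ)).subset fun m hm ↦ ?_
  by_contra h
  exact hm (norm_inversePowerSum_le hk N z h b)

/-- The iterated sum of `(m z + n) ^ (-k)` over `(m, n) ≡ x` modulo `N`. -/
def latticeSum (k N : ℕ) (z : UpperHalfPlane) (x : Fin 2 → ℤ) : ℂ :=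
  ∑' m : ℤ, inversePowerSum k N (((N * m + x 0 : ℤ) : ℂ) * z) (x 1)

theorem summable_latticeSum {k : ℕ} (hk : 2 ≤ k) (N : ℕ) [NeZero N] (z : UpperHalfPlane)
    (x : Fin 2 → ℤ) :
    Summable fun m : ℤ ↦ inversePowerSum k N (((N * m + x 0 : ℤ) : ℂ) * z) (x 1) :=
  (summable_rows hk N z (x 1)).comp_injective (mul_add_injective N (x 0))

theorem latticeSum_add_mul (k N : ℕ) (z : UpperHalfPlane) (x y : Fin 2 → ℤ) :
    latticeSum k N z (x + (N : ℤ) • y) = latticeSum k N z x := by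
  rw [latticeSum, ← (Equiv.addRight (-y 0)).tsum_eq, latticeSum]
  refine tsum_congr fun m ↦ ?_
  simp only [Equiv.coe_addRight, Pi.add_apply, Pi.smul_apply, smul_eq_mul,
    inversePowerSum_add_mul]
  congr 3
  ring

theorem latticeSum_congr (k N : ℕ) (z : UpperHalfPlane) {x y : Fin 2 → ℤ}
    (h : ∀ i, (x i : ZMod N) = y i) : latticeSum k N z x = latticeSum k N z y := by
  have h' (i : Fin 2) : ∃ c : ℤ, x i = y i + N * c := by
    obtain ⟨c, hc⟩ := (ZMod.intCast_eq_intCast_iff_dvd_sub (y i) (x i) N).mp (h i).symm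
    exact ⟨c, by linarith⟩
  choose c hc using h'
  have : x = y + (N : ℤ) • c := funext fun i ↦ by simp [hc]
  rw [this, latticeSum_add_mul]

open Filter in
theorem tendsto_inversePowerSum {k : ℕ} (hk : 2 ≤ k) (N : ℕ) [NeZero N] {m : ℤ} (hm : m ≠ 0)
    (b : ℤ) : Tendsto (fun z : UpperHalfPlane ↦ inversePowerSum k N (m * z) b)
      UpperHalfPlane.atImInfty (nhds 0) := by
  have hpos : 0 < m.natAbs := Int.natAbs_pos.mpr hm
  have h1 : Tendsto (fun z ↦ rowConst k N * (qNorm N z / (1 / 2) *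
      qMajorant k (1 / 2) m.natAbs)) UpperHalfPlane.atImInfty (nhds 0) := by
    simpa using (((tendsto_qNorm N).div_const (1 / 2)).mul_const _).const_mul (rowConst k N)
  refine squeeze_zero_norm' ?_ h1
  filter_upwards [(tendsto_qNorm N).eventually_le_const (u := 1 / 2) one_half_pos] with z hz
  refine (norm_inversePowerSum_le hk N z hm b).trans ?_
  refine mul_le_mul_of_nonneg_left ?_ (norm_nonneg _)
  exact qMajorant_le k (qNorm_pos N z).le hz one_half_pos one_half_lt_one ⟨m.natAbs, hpos⟩

/-- A summable majorant, uniform near infinity, of the rows of a lattice sum. -/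
def rowMajorant (k N : ℕ) (c : ℝ) (j : ℤ) : ℝ :=
  if j = 0 then c else rowConst k N * qMajorant k (1 / 2) j.natAbs

open Filter in
theorem summable_rowMajorant (k N : ℕ) (c : ℝ) : Summable (rowMajorant k N c) := by
  refine Summable.congr_cofinite ((summable_qMajorant_natAbs k one_half_pos.le
    one_half_lt_one).mul_left (rowConst k N)) ?_
  rw [EventuallyEq, Filter.eventually_cofinite]
  refine (Set.finite_singleton (0 : ℤ)).subset fun m hm ↦ ?_
  by_contra h
  exact hm (if_neg h).symm

theorem norm_inversePowerSum_le_rowMajorant {k : ℕ} (hk : 2 ≤ k) (N : ℕ) [NeZero N]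
    {z : UpperHalfPlane} (hz : qNorm N z ≤ 1 / 2) (m b : ℤ) :
    ‖inversePowerSum k N (m * z) b‖ ≤ rowMajorant k N ‖inversePowerSum k N 0 b‖ m := by
  rw [rowMajorant]
  split_ifs with h
  · simp [h]
  · refine (norm_inversePowerSum_le hk N z h _).trans
      (mul_le_mul_of_nonneg_left ?_ (norm_nonneg _))
    refine (qMajorant_le k (qNorm_pos N z).le hz one_half_pos one_half_lt_one
      ⟨_, Int.natAbs_pos.mpr h⟩).trans
        (mul_le_of_le_one_left (qMajorant_nonneg k one_half_pos.le _) ?_)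
    exact (div_le_one one_half_pos).mpr hz

-- Dominated convergence: every row tends to zero except the one with `N * m + x 0 = 0`, which is
-- constant in `z` and exists exactly when `x 0` vanishes modulo `N`. In that row the vector `(0,
-- 0)`, if present, contributes `0⁻¹ = 0`.
open Filter in
theorem tendsto_latticeSum {k : ℕ} (hk : 2 ≤ k) (N : ℕ) [NeZero N] (x : Fin 2 → ℤ) :
    Tendsto (fun z ↦ latticeSum k N z x) UpperHalfPlane.atImInfty
      (nhds (if (x 0 : ZMod N) = 0 then inversePowerSum k N 0 (x 1) else 0)) := by
  have hlim : (∑' m : ℤ, if N * m + x 0 = 0 then inversePowerSum k N 0 (x 1) else 0) =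
      if (x 0 : ZMod N) = 0 then inversePowerSum k N 0 (x 1) else 0 := by
    split_ifs with h
    · obtain ⟨c, hc⟩ := (ZMod.intCast_zmod_eq_zero_iff_dvd _ _).mp h
      rw [tsum_eq_single (-c), if_pos (by rw [hc]; ring)]
      intro m hm
      rw [if_neg]
      intro h0
      have hN : (N : ℤ) ≠ 0 := Nat.cast_ne_zero.mpr (NeZero.ne N)
      refine hm (mul_left_cancel₀ hN ?_)
      linarith
    · have (m : ℤ) : ¬ N * m + x 0 = 0 := fun h0 ↦ h <|
        (ZMod.intCast_zmod_eq_zero_iff_dvd _ _).mpr ⟨-m, by linarith⟩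
      simp [this]
  rw [← hlim]
  have hsum := (summable_rowMajorant k N ‖inversePowerSum k N 0 (x 1)‖).comp_injective
    (mul_add_injective N (x 0))
  refine tendsto_tsum_of_dominated_convergence hsum (fun m ↦ ?_) ?_
  · split_ifs with h
    · simp [h]
    · exact tendsto_inversePowerSum hk N h _
  · filter_upwards [(tendsto_qNorm N).eventually_le_const (u := 1 / 2) one_half_pos] with z hz m
    exact norm_inversePowerSum_le_rowMajorant hk N hz _ _

end

/-! ### Absolute convergence, regularization in weight two, and the action of `SL₂(ℤ)`. -/

noncomputable section

open EisensteinSeries Filter Asymptotics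

theorem smul_injective_fin_two (N : ℕ) [NeZero N] :
    Function.Injective fun ω : Fin 2 → ℤ ↦ (N : ℤ) • ω :=
  smul_right_injective _ (Nat.cast_ne_zero.mpr (NeZero.ne N))

/-- The lattice form `v₀ z + v₁`. -/
def latticeForm (z : UpperHalfPlane) (v : Fin 2 → ℤ) : ℂ := v 0 * (z : ℂ) + v 1

theorem eisSummand_eq_inv_pow (k : ℕ) (v : Fin 2 → ℤ) (z : UpperHalfPlane) :
    eisSummand k v z = (latticeForm z v)⁻¹ ^ k := by
  rw [eisSummand, latticeForm, zpow_neg, zpow_natCast, inv_pow]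

theorem latticeForm_add (z : UpperHalfPlane) (v w : Fin 2 → ℤ) :
    latticeForm z (v + w) = latticeForm z v + latticeForm z w := by
  simp [latticeForm]; ring

theorem latticeForm_ne_zero (z : UpperHalfPlane) {v : Fin 2 → ℤ} (hv : v ≠ 0) :
    latticeForm z v ≠ 0 := by
  intro h
  have h0 : (v 0 : ℝ) * z.im = 0 := by simpa [latticeForm] using congrArg Complex.im h
  have h1 : v 0 = 0 := by simpa [z.im_ne_zero] using h0
  have h2 : v 1 = 0 := by simpa [latticeForm, h1] using h
  exact hv (funext fun i ↦ by fin_cases i <;> simp [h1, h2])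

theorem latticeForm_inv_isBigO (N : ℕ) [NeZero N] (z : UpperHalfPlane) (x : Fin 2 → ℤ) :
    (fun ω : Fin 2 → ℤ ↦ (latticeForm z ((N : ℤ) • ω + x))⁻¹) =O[cofinite]
      fun ω ↦ ‖ω‖⁻¹ := by
  have h := (isBigO_linear_add_const_vec z (x 0) (x 1)).comp_tendsto
    (smul_injective_fin_two N).tendsto_cofinite
  refine (IsBigO.congr_left (f₁ := _) h fun ω ↦ ?_).trans ?_
  · simp only [latticeForm, Function.comp, Pi.add_apply, Int.cast_add]
    congr 1
    ring
  · refine IsBigO.of_bound 1 (Eventually.of_forall fun ω ↦ ?_)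
    have hN : (1 : ℝ) ≤ N := by exact_mod_cast NeZero.pos N
    rcases eq_or_ne ω 0 with rfl | hω
    · simp
    · have : 0 < ‖ω‖ := norm_pos_iff.mpr hω
      simp only [Function.comp, norm_inv, norm_norm, norm_smul, norm_mul, one_mul]
      refine inv_anti₀ this (le_mul_of_one_le_left this.le ?_)
      simpa using hN

theorem isBigO_norm_inv_pow {m : ℕ} {f : (Fin 2 → ℤ) → ℂ}
    (h : f =O[cofinite] fun ω ↦ ‖ω‖⁻¹ ^ m) (hm : 3 ≤ m) : Summable f := by
  refine summable_of_isBigO_rpow_norm (a := m) (by exact_mod_cast hm) ?_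
  simpa using h

theorem summable_eisSummand_smul_add {k : ℕ} (hk : 3 ≤ k) (N : ℕ) [NeZero N]
    (z : UpperHalfPlane) (x : Fin 2 → ℤ) :
    Summable fun ω : Fin 2 → ℤ ↦ eisSummand k ((N : ℤ) • ω + x) z := by
  simp_rw [eisSummand_eq_inv_pow]
  exact isBigO_norm_inv_pow ((latticeForm_inv_isBigO N z x).pow k) hk

/-- With `A` and `B` the forms at `Nω + x` and `Nω`, the difference `A⁻² - B⁻²` equals `-(A - B) A⁻¹
B⁻¹ (A⁻¹ + B⁻¹)`. Since `A - B` is constant in `ω`, this is `O(‖ω‖⁻³)`, which is summable in rank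
two. -/
theorem summable_eisSummand_two_sub (N : ℕ) [NeZero N] (z : UpperHalfPlane) (x : Fin 2 → ℤ) :
    Summable fun ω : Fin 2 → ℤ ↦
      eisSummand (2 : ℕ) ((N : ℤ) • ω + x) z - eisSummand (2 : ℕ) ((N : ℤ) • ω) z := by
  simp_rw [eisSummand_eq_inv_pow]
  have hx := latticeForm_inv_isBigO N z x
  have h0 := latticeForm_inv_isBigO N z 0
  simp only [add_zero] at h0
  refine isBigO_norm_inv_pow (m := 3) ?_ le_rfl
  have h := ((hx.mul h0).mul (hx.add h0)).const_mul_left (-latticeForm z x)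
  refine (h.congr' ?_ (Eventually.of_forall fun ω ↦ by ring : _ =ᶠ[cofinite] _))
  -- The algebraic identity needs both forms to be non-zero, which excludes at most two values of
  -- `ω`.
  have hfin : ({ω | (N : ℤ) • ω + x = 0} ∪ {ω : Fin 2 → ℤ | (N : ℤ) • ω = 0}).Finite := by
    refine Set.Finite.union ?_ ?_
    · refine Set.Subsingleton.finite fun a ha b hb ↦ smul_injective_fin_two N ?_
      exact add_right_cancel (Eq.trans ha (Eq.symm hb))
    · exact Set.Subsingleton.finite fun a ha b hb ↦ smul_injective_fin_two N (ha.trans hb.symm)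
  rw [EventuallyEq, eventually_cofinite]
  refine hfin.subset fun ω hω ↦ ?_
  by_contra hc
  rw [Set.mem_union, not_or] at hc
  refine hω ?_
  have h1 := latticeForm_ne_zero z hc.1
  have h2 := latticeForm_ne_zero z hc.2
  rw [latticeForm_add] at h1 ⊢
  field_simp
  ring

/-- The lattice sum over the class of `x` modulo `N`, regularized by subtracting `c` times the
corresponding sum over the class of `0`. -/
def regLatticeSum (k N : ℕ) (c : ℂ) (z : UpperHalfPlane) (x : Fin 2 → ℤ) : ℂ :=
  ∑' ω : Fin 2 → ℤ, (eisSummand k ((N : ℤ) • ω + x) z - c * eisSummand k ((N : ℤ) • ω) z)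

theorem summable_regLatticeSum {k : ℕ} (hk : 2 ≤ k) {c : ℂ} (hc : c = 1 ∨ 3 ≤ k) (N : ℕ) [NeZero N]
    (z : UpperHalfPlane) (x : Fin 2 → ℤ) : Summable fun ω : Fin 2 → ℤ ↦
      (eisSummand k ((N : ℤ) • ω + x) z - c * eisSummand k ((N : ℤ) • ω) z) := by
  by_cases h3 : 3 ≤ k
  · refine (summable_eisSummand_smul_add h3 N z x).sub (Summable.mul_left _ ?_)
    simpa using summable_eisSummand_smul_add h3 N z 0
  · obtain rfl : k = 2 := by omega
    obtain rfl := hc.resolve_right h3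
    simpa using summable_eisSummand_two_sub N z x

/-- Absolute convergence of the regularized family allows summation by rows. For `k = 2` the two
pieces on the right make sense only as iterated sums. -/
theorem regLatticeSum_eq {k : ℕ} (hk : 2 ≤ k) {c : ℂ} (hc : c = 1 ∨ 3 ≤ k) (N : ℕ) [NeZero N]
    (z : UpperHalfPlane) (x : Fin 2 → ℤ) :
    regLatticeSum k N c z x = latticeSum k N z x - c * latticeSum k N z 0 := by
  have hterm (x : Fin 2 → ℤ) (m n : ℤ) : eisSummand k ((N : ℤ) • ![m, n] + x) z =
      (((((N * m + x 0 : ℤ) : ℂ) * z) + ((N * n + x 1 : ℤ) : ℂ)) ^ k)⁻¹ := by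
    rw [eisSummand_eq_inv_pow, inv_pow]
    simp [latticeForm]
  have hterm0 (m n : ℤ) : eisSummand k ((N : ℤ) • ![m, n]) z =
      (((((N * m + (0 : Fin 2 → ℤ) 0 : ℤ) : ℂ) * z) +
        ((N * n + (0 : Fin 2 → ℤ) 1 : ℤ) : ℂ)) ^ k)⁻¹ := by
    rw [← hterm, add_zero]
  have hs : Summable fun p : ℤ × ℤ ↦
      (eisSummand k ((N : ℤ) • (finTwoArrowEquiv ℤ).symm p + x) z -
        c * eisSummand k ((N : ℤ) • (finTwoArrowEquiv ℤ).symm p) z) :=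
    (finTwoArrowEquiv ℤ).symm.summable_iff.mpr (summable_regLatticeSum hk hc N z x)
  rw [regLatticeSum, ← (finTwoArrowEquiv ℤ).symm.tsum_eq, Summable.tsum_prod hs, latticeSum,
    latticeSum, ← tsum_mul_left, ← (summable_latticeSum hk N z x).tsum_sub
      ((summable_latticeSum hk N z 0).mul_left c)]
  refine tsum_congr fun m ↦ ?_
  simp only [finTwoArrowEquiv_symm_apply, hterm, hterm0]
  rw [(summable_inversePowerSum hk N _ _).tsum_sub
    ((summable_inversePowerSum hk N _ _).mul_left c), tsum_mul_left]
  rfl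

theorem Matrix.SpecialLinearGroup.cast_det_fin_two (R : Type*) [CommRing R] (γ : SL(2, ℤ)) :
    ((γ 0 0 : ℤ) : R) * (γ 1 1 : ℤ) - (γ 0 1 : ℤ) * (γ 1 0 : ℤ) = 1 := by
  have h := γ.det_coe
  rw [Matrix.det_fin_two] at h
  exact_mod_cast congrArg (Int.cast : ℤ → R) h

/-- Right multiplication by an element of `SL₂(ℤ)` on row vectors over a ring. -/
def rowEquiv (R : Type*) [CommRing R] (γ : SL(2, ℤ)) : (Fin 2 → R) ≃ (Fin 2 → R) where
  toFun v := ![v 0 * (γ 0 0 : ℤ) + v 1 * (γ 1 0 : ℤ), v 0 * (γ 0 1 : ℤ) + v 1 * (γ 1 1 : ℤ)]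
  invFun v := ![v 0 * (γ 1 1 : ℤ) - v 1 * (γ 1 0 : ℤ), -v 0 * (γ 0 1 : ℤ) + v 1 * (γ 0 0 : ℤ)]
  left_inv v := by
    have h := γ.cast_det_fin_two R
    refine funext (Fin.forall_fin_two.mpr ⟨?_, ?_⟩)
    · simp only [Matrix.cons_val_zero, Matrix.cons_val_one]
      linear_combination v 0 * h
    · simp only [Matrix.cons_val_zero, Matrix.cons_val_one]
      linear_combination v 1 * h
  right_inv v := by
    have h := γ.cast_det_fin_two R
    refine funext (Fin.forall_fin_two.mpr ⟨?_, ?_⟩)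
    · simp only [Matrix.cons_val_zero, Matrix.cons_val_one]
      linear_combination v 0 * h
    · simp only [Matrix.cons_val_zero, Matrix.cons_val_one]
      linear_combination v 1 * h

theorem rowEquiv_apply (R : Type*) [CommRing R] (γ : SL(2, ℤ)) (v : Fin 2 → R) :
    rowEquiv R γ v = ![v 0 * (γ 0 0 : ℤ) + v 1 * (γ 1 0 : ℤ),
      v 0 * (γ 0 1 : ℤ) + v 1 * (γ 1 1 : ℤ)] := rfl

theorem rowEquiv_symm_apply (R : Type*) [CommRing R] (γ : SL(2, ℤ)) (v : Fin 2 → R) :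
    (rowEquiv R γ).symm v = ![v 0 * (γ 1 1 : ℤ) - v 1 * (γ 1 0 : ℤ),
      -v 0 * (γ 0 1 : ℤ) + v 1 * (γ 0 0 : ℤ)] := rfl

theorem eisSummand_smul (k : ℕ) (γ : SL(2, ℤ)) (v : Fin 2 → ℤ) (z : UpperHalfPlane) :
    eisSummand k v (γ • z) = UpperHalfPlane.denom γ z ^ k * eisSummand k (rowEquiv ℤ γ v) z := by
  rw [eisSummand_SL2_apply, zpow_natCast]
  congr 2
  refine funext (Fin.forall_fin_two.mpr ⟨?_, ?_⟩) <;>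
    simp [rowEquiv_apply, Matrix.vecMul, dotProduct, Fin.sum_univ_two]

/-- Right multiplication by `γ` permutes the lattice and preserves the class of `0`, so the
regularizing term transforms along with the main one. -/
theorem regLatticeSum_smul (k N : ℕ) (c : ℂ) (γ : SL(2, ℤ)) (z : UpperHalfPlane)
    (x : Fin 2 → ℤ) : regLatticeSum k N c (γ • z) x =
      UpperHalfPlane.denom γ z ^ k * regLatticeSum k N c z (rowEquiv ℤ γ x) := by
  have hadd (v w : Fin 2 → ℤ) : rowEquiv ℤ γ ((N : ℤ) • v + w) =
      (N : ℤ) • rowEquiv ℤ γ v + rowEquiv ℤ γ w := by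
    refine funext (Fin.forall_fin_two.mpr ⟨?_, ?_⟩) <;> simp [rowEquiv_apply] <;> ring
  have hsmul (v : Fin 2 → ℤ) : rowEquiv ℤ γ ((N : ℤ) • v) = (N : ℤ) • rowEquiv ℤ γ v := by
    refine funext (Fin.forall_fin_two.mpr ⟨?_, ?_⟩) <;> simp [rowEquiv_apply] <;> ring
  rw [regLatticeSum, regLatticeSum, ← tsum_mul_left]
  conv_rhs => rw [← (rowEquiv ℤ γ).tsum_eq]
  refine tsum_congr fun ω ↦ ?_
  rw [eisSummand_smul, eisSummand_smul, hadd, hsmul]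
  ring

/-- The linear combination of lattice sums with coefficients `a` on the classes modulo `N`. -/
def weightedLatticeSum (k N : ℕ) [NeZero N] (a : (Fin 2 → ZMod N) → ℂ) (z : UpperHalfPlane) : ℂ :=
  ∑ x, a x * latticeSum k N z fun i ↦ (x i).cast

theorem weightedLatticeSum_smul {k : ℕ} (hk : 2 ≤ k) (N : ℕ) [NeZero N]
    {a : (Fin 2 → ZMod N) → ℂ} (ha : ∑ x, a x = 0 ∨ 3 ≤ k) (γ : SL(2, ℤ)) (z : UpperHalfPlane) :
    weightedLatticeSum k N a (γ • z) = UpperHalfPlane.denom γ z ^ k *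
      weightedLatticeSum k N (a ∘ (rowEquiv (ZMod N) γ).symm) z := by
  -- Either the coefficients sum to zero and `c = 1` regularizes for free, or `k ≥ 3` and no
  -- correction is needed, so `c = 0`.
  obtain ⟨c, hc, hca⟩ : ∃ c : ℂ, (c = 1 ∨ 3 ≤ k) ∧ c * ∑ x, a x = 0 := by
    rcases ha with h | h
    · exact ⟨1, Or.inl rfl, by rw [h, mul_zero]⟩
    · exact ⟨0, Or.inr h, zero_mul _⟩
  have key (f : (Fin 2 → ZMod N) → Fin 2 → ℤ) (w : UpperHalfPlane) :
      ∑ x, a x * regLatticeSum k N c w (f x) = ∑ x, a x * latticeSum k N w (f x) := by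
    simp_rw [regLatticeSum_eq hk hc, mul_sub, Finset.sum_sub_distrib, ← Finset.sum_mul]
    rw [← mul_assoc, mul_comm _ c, hca, zero_mul, sub_zero]
  rw [weightedLatticeSum, ← key]
  simp_rw [regLatticeSum_smul, mul_left_comm (a _)]
  rw [← Finset.mul_sum, key, weightedLatticeSum]
  congr 1
  refine Fintype.sum_equiv (rowEquiv (ZMod N) γ) _ _ fun x ↦ ?_
  rw [Function.comp, Equiv.symm_apply_apply]
  congr 1
  refine latticeSum_congr k N z fun i ↦ ?_
  rw [ZMod.intCast_cast, ZMod.cast_id', id, rowEquiv_apply, rowEquiv_apply]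
  fin_cases i <;> simp

theorem tendsto_weightedLatticeSum {k : ℕ} (hk : 2 ≤ k) (N : ℕ) [NeZero N]
    (a : (Fin 2 → ZMod N) → ℂ) :
    Tendsto (weightedLatticeSum k N a) UpperHalfPlane.atImInfty
      (nhds (∑ d : ZMod N, a ![0, d] * inversePowerSum k N 0 d.cast)) := by
  have h : (∑ x : Fin 2 → ZMod N, a x * (if (((x 0).cast : ℤ) : ZMod N) = 0 then
      inversePowerSum k N 0 (x 1).cast else 0)) =
      ∑ d : ZMod N, a ![0, d] * inversePowerSum k N 0 d.cast := by
    rw [← (finTwoArrowEquiv (ZMod N)).symm.sum_comp, Fintype.sum_prod_type,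
      Finset.sum_eq_single 0]
    · simp [finTwoArrowEquiv_symm_apply]
    · intro m _ hm
      simp [finTwoArrowEquiv_symm_apply, hm]
    · simp
  rw [← h]
  exact tendsto_finsetSum _ fun x _ ↦ (tendsto_latticeSum hk N _).const_mul _

/-- A lattice sum whose coefficients are periodic modulo `N`, as an iterated sum over all rows. -/
theorem weightedLatticeSum_eq_tsum {k : ℕ} (hk : 2 ≤ k) (N : ℕ) [NeZero N]
    (a : (Fin 2 → ZMod N) → ℂ) (z : UpperHalfPlane) :
    HasSum (fun m : ℤ ↦ ∑ d : ZMod N, a ![m, d] * inversePowerSum k N (m * z) d.cast)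
      (weightedLatticeSum k N a z) := by
  have hs : Summable fun m : ℤ ↦
      ∑ d : ZMod N, a ![m, d] * inversePowerSum k N (m * z) d.cast := by
    refine summable_sum fun d _ ↦ ?_
    refine Summable.of_norm_bounded (g := fun m : ℤ ↦ (∑ x, ‖a x‖) *
      ‖inversePowerSum k N (m * z) d.cast‖) ((summable_rows hk N z _).norm.mul_left _) fun m ↦ ?_
    rw [norm_mul]
    exact mul_le_mul_of_nonneg_right (Finset.single_le_sum (f := fun x ↦ ‖a x‖)
      (fun x _ ↦ norm_nonneg _) (Finset.mem_univ _)) (norm_nonneg _)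
  convert hs.hasSum using 1
  rw [← Int.sum_tsum_residue_classes hs N, weightedLatticeSum,
    ← (finTwoArrowEquiv (ZMod N)).symm.sum_comp, Fintype.sum_prod_type]
  refine Finset.sum_congr rfl fun j _ ↦ ?_
  have (m : ℤ) : (((N * m + (j.cast : ℤ) : ℤ)) : ZMod N) = j := by simp
  simp_rw [this]
  rw [Summable.tsum_finsetSum fun d _ ↦ ?_]
  · refine Finset.sum_congr rfl fun d _ ↦ ?_
    rw [tsum_mul_left]
    rfl
  · exact (summable_latticeSum hk N z ![j.cast, d.cast]).mul_left _

end

/-! ### The Eisenstein series as a weighted lattice sum. -/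

noncomputable section

/-- The sum of `ψ(n) (w + n) ^ (-k)` over all integers `n`. -/
def characterPowerSum {f : ℕ} (k : ℕ) (ψ : DirichletCharacter ℂ f) (w : ℂ) : ℂ :=
  ∑' n : ℤ, ψ (n : ZMod f) * ((w + n) ^ k)⁻¹

theorem summable_characterPowerSum {f : ℕ} {k : ℕ} (hk : 2 ≤ k) (ψ : DirichletCharacter ℂ f)
    (w : ℂ) : Summable fun n : ℤ ↦ ψ (n : ZMod f) * ((w + n) ^ k)⁻¹ := by
  refine Summable.of_norm_bounded (summable_inv_add_pow hk w).norm fun n ↦ ?_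
  rw [norm_mul]
  exact mul_le_of_le_one_left (norm_nonneg _) (ψ.norm_le_one _)

theorem sum_character_mul_inversePowerSum {f N : ℕ} [NeZero N] (hfN : f ∣ N) {k : ℕ} (hk : 2 ≤ k)
    (ψ : DirichletCharacter ℂ f) (w : ℂ) :
    ∑ d : ZMod N, ψ ((d.cast : ℤ) : ZMod f) * inversePowerSum k N w d.cast =
      characterPowerSum k ψ w := by
  rw [characterPowerSum, ← Int.sum_tsum_residue_classes (summable_characterPowerSum hk ψ w) N]
  refine Finset.sum_congr rfl fun d _ ↦ ?_
  rw [inversePowerSum, ← tsum_mul_left]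
  refine tsum_congr fun n ↦ ?_
  have : (N : ZMod f) = 0 := (ZMod.natCast_eq_zero_iff _ _).mpr hfN
  congr 2
  push_cast
  rw [this]
  ring

theorem characterPowerSum_neg {f k : ℕ} (ψ : DirichletCharacter ℂ f) (w : ℂ) :
    characterPowerSum k ψ (-w) = ψ (-1) * (-1) ^ k * characterPowerSum k ψ w := by
  rw [characterPowerSum, ← (Equiv.neg ℤ).tsum_eq, characterPowerSum, ← tsum_mul_left]
  refine tsum_congr fun n ↦ ?_
  have e1 : (((Equiv.neg ℤ) n : ℤ) : ZMod f) = -1 * n := by simp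
  have e2 : (-w + (((Equiv.neg ℤ) n : ℤ) : ℂ)) = -1 * (w + n) := by simp; ring
  rw [e1, e2, map_mul, mul_pow, mul_inv, ← inv_pow, inv_neg_one]
  ring

theorem characterPowerSum_zero {f k : ℕ} (hk : 2 ≤ k) (ψ : DirichletCharacter ℂ f)
    (hpar : ψ (-1) = (-1) ^ k) :
    characterPowerSum k ψ 0 = 2 * LSeries (fun n ↦ ψ (n : ZMod f)) k := by
  rw [← (hasSum_int_character_div_pow ψ hk hpar).tsum_eq, characterPowerSum]
  simp_rw [zero_add]

-- In Lipschitz's formula the residue class `d` enters only through the additive character, so the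
-- sum over `d` weighted by `ψ` is a Gauss sum. The factor `f` in the argument cancels the
-- denominator in the exponent and leaves integral powers of `exp(2πiz)`.
open Complex in
theorem characterPowerSum_eq_tsum_exp {f : ℕ} [NeZero f] {k : ℕ} (hk : 2 ≤ k)
    {ψ : DirichletCharacter ℂ f} (hψ : ψ.IsPrimitive) (z : UpperHalfPlane) (j : ℕ+) :
    characterPowerSum k ψ (((f : ℤ) * (j : ℤ) : ℤ) * z) =
      ((f : ℂ) ^ k)⁻¹ * ((-2 * Real.pi * I) ^ k / (k - 1).factorial) * gaussW ψ *
        ∑' l : ℕ+, ψ⁻¹ ((l : ℕ) : ZMod f) * (l : ℂ) ^ (k - 1) *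
          cexp (2 * Real.pi * I * z) ^ (j * l : ℕ) := by
  have hf : (f : ℂ) ≠ 0 := Nat.cast_ne_zero.mpr (NeZero.ne f)
  have hw : 0 < ((((f : ℤ) * (j : ℤ) : ℤ) : ℂ) * z).im := by
    have := z.im_pos
    have : (0 : ℝ) < f := Nat.cast_pos.mpr (NeZero.pos f)
    have : (0 : ℝ) < (j : ℕ) := Nat.cast_pos.mpr j.pos
    simpa using by positivity
  have hexp (d : ZMod f) (l : ℕ+) : cexp (2 * Real.pi * I *
      (((((f : ℤ) * (j : ℤ) : ℤ) : ℂ) * z + (d.cast : ℤ)) / f)) ^ (l : ℕ) =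
      cexp (2 * Real.pi * I * z) ^ (j * l : ℕ) * ZMod.stdAddChar ((l : ZMod f) * d) := by
    have e : (l : ZMod f) * d = (((l : ℕ) * d.cast : ℤ) : ZMod f) := by simp
    rw [e, ZMod.stdAddChar_coe, ← exp_nat_mul, ← exp_nat_mul, ← exp_add]
    congr 1
    push_cast
    field_simp
  have hgauss (l : ℕ+) : ∑ d : ZMod f, ψ d * ZMod.stdAddChar ((l : ZMod f) * d) =
      ψ⁻¹ ((l : ℕ) : ZMod f) * gaussW ψ := by
    rw [gaussW, ← gaussSum_mulShift_of_isPrimitive _ hψ]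
    simp [gaussSum, AddChar.mulShift_apply]
  have hsum : Summable fun l : ℕ+ ↦ (l : ℂ) ^ (k - 1) *
      cexp (2 * Real.pi * I * z) ^ (j * l : ℕ) := by
    have h : Summable fun c : ℕ+ × ℕ+ ↦ (c.2 : ℂ) ^ (k - 1) *
        cexp (2 * Real.pi * I * z) ^ (c.1 * c.2 : ℕ) :=
      summable_prod_mul_pow (k - 1) (UpperHalfPlane.norm_exp_two_pi_I_lt_one z)
    exact h.prod_factor j
  rw [← sum_character_mul_inversePowerSum dvd_rfl hk]
  simp_rw [inversePowerSum_eq_tsum_exp hk f hw, hexp, ZMod.intCast_cast, ZMod.cast_id', id,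
    mul_left_comm (ψ _), ← tsum_mul_left]
  rw [← Summable.tsum_finsetSum fun d _ ↦ ?_]
  · refine tsum_congr fun l ↦ ?_
    have h1 (d : ZMod f) (A L E : ℂ) : A * (ψ d * (L * (E * ZMod.stdAddChar ((l : ZMod f) * d)))) =
        A * L * E * (ψ d * ZMod.stdAddChar ((l : ZMod f) * d)) := by ring
    simp_rw [h1]
    rw [← Finset.mul_sum, hgauss]
    ring
  · refine Summable.mul_left _ (Summable.of_norm_bounded hsum.norm fun l ↦ ?_)
    rw [← mul_assoc (_ ^ (k - 1)), norm_mul, norm_mul, AddChar.norm_apply, mul_one]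
    exact mul_le_of_le_one_left (norm_nonneg _) (ψ.norm_le_one _)

open Complex in
theorem tsum_tsum_eq_tsum_twistedSigma {f₁ f₂ : ℕ} (k : ℕ) (χ₁ : DirichletCharacter ℂ f₁)
    (χ₂ : DirichletCharacter ℂ f₂) {q : ℂ} (hq : ‖q‖ < 1) :
    ∑' j : ℕ+, ∑' l : ℕ+, χ₁ ((j : ℕ) : ZMod f₁) * (χ₂ ((l : ℕ) : ZMod f₂) * (l : ℂ) ^ (k - 1) *
      q ^ (j * l : ℕ)) = ∑' n : ℕ+, twistedSigma χ₁ χ₂ k n * q ^ (n : ℕ) := by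
  have hs : Summable fun c : ℕ+ × ℕ+ ↦ χ₁ ((c.1 : ℕ) : ZMod f₁) *
      (χ₂ ((c.2 : ℕ) : ZMod f₂) * (c.2 : ℂ) ^ (k - 1) * q ^ (c.1 * c.2 : ℕ)) := by
    have h : Summable fun c : ℕ+ × ℕ+ ↦ (c.2 : ℂ) ^ (k - 1) * q ^ (c.1 * c.2 : ℕ) :=
      summable_prod_mul_pow (k - 1) hq
    refine Summable.of_norm_bounded h.norm fun c ↦ ?_
    rw [mul_assoc (χ₂ _), norm_mul, norm_mul (χ₂ _)]
    exact (mul_le_of_le_one_left (by positivity) (χ₁.norm_le_one _)).trans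
      (mul_le_of_le_one_left (norm_nonneg _) (χ₂.norm_le_one _))
  rw [← hs.tsum_prod, ← sigmaAntidiagonalEquivProd.tsum_eq]
  refine (Summable.tsum_sigma (sigmaAntidiagonalEquivProd.summable_iff.mpr hs)).trans ?_
  refine tsum_congr fun n ↦ ?_
  rw [tsum_fintype]
  refine (Finset.sum_attach (n : ℕ).divisorsAntidiagonal fun x : ℕ × ℕ ↦ χ₁ (x.1 : ZMod f₁) *
    (χ₂ (x.2 : ZMod f₂) * (x.2 : ℂ) ^ (k - 1) * q ^ (x.1 * x.2))).trans ?_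
  rw [Nat.sum_divisorsAntidiagonal' fun a b ↦ χ₁ (a : ZMod f₁) *
    (χ₂ (b : ZMod f₂) * (b : ℂ) ^ (k - 1) * q ^ (a * b)), twistedSigma, Finset.sum_mul]
  refine Finset.sum_congr rfl fun m hm ↦ ?_
  rw [Nat.div_mul_cancel (Nat.dvd_of_mem_divisors hm)]
  ring

variable {f₁ f₂ : ℕ} [NeZero f₂]

/-- The coefficients `(m, n) ↦ χ₁(m / f₂) ψ(n)` modulo `f₁ f₂`, supported on `f₂ ∣ m`. -/
def eisensteinCoeff (χ₁ : DirichletCharacter ℂ f₁) (ψ : DirichletCharacter ℂ f₂)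
    (x : Fin 2 → ZMod (f₁ * f₂)) : ℂ :=
  (if (f₂ : ℤ) ∣ (x 0).cast then χ₁ (((x 0).cast / f₂ : ℤ) : ZMod f₁) else 0) *
    ψ (((x 1).cast : ℤ) : ZMod f₂)

/-- The choice of representatives is immaterial: `m` modulo `f₁ f₂` determines whether `f₂ ∣ m` and,
if so, `m / f₂` modulo `f₁`. -/
theorem eisensteinCoeff_intCast (χ₁ : DirichletCharacter ℂ f₁) (ψ : DirichletCharacter ℂ f₂)
    (m n : ℤ) : eisensteinCoeff χ₁ ψ ![(m : ZMod (f₁ * f₂)), (n : ZMod (f₁ * f₂))] =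
      (if (f₂ : ℤ) ∣ m then χ₁ ((m / f₂ : ℤ) : ZMod f₁) else 0) * ψ (n : ZMod f₂) := by
  have hf₂ : (f₂ : ℤ) ≠ 0 := Nat.cast_ne_zero.mpr (NeZero.ne f₂)
  have e1 : (((n % (f₁ * f₂ : ℕ) : ℤ)) : ZMod f₂) = n := by
    rw [ZMod.intCast_eq_intCast_iff]
    exact (Int.mod_modEq n _).of_dvd (by exact_mod_cast Dvd.intro_left f₁ rfl)
  simp only [eisensteinCoeff, Matrix.cons_val_zero, Matrix.cons_val_one, ZMod.coe_intCast, e1]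
  congr 1
  by_cases h : (f₂ : ℤ) ∣ m
  · obtain ⟨c, rfl⟩ := h
    have e2 : (f₂ * c : ℤ) % (f₁ * f₂ : ℕ) = f₂ * (c % f₁) := by
      push_cast
      rw [mul_comm (f₁ : ℤ), Int.mul_emod_mul_of_pos _ _ (by have := NeZero.pos f₂; omega)]
    rw [e2, if_pos (dvd_mul_right _ _), if_pos (dvd_mul_right _ _),
      Int.mul_ediv_cancel_left _ hf₂, Int.mul_ediv_cancel_left _ hf₂]
    congr 1
    rw [ZMod.intCast_eq_intCast_iff]
    exact Int.mod_modEq _ _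
  · rw [if_neg h, if_neg]
    rwa [EuclideanDomain.dvd_mod_iff (by exact_mod_cast Dvd.intro_left f₁ rfl)]

theorem eisensteinCoeff_mul_intCast (χ₁ : DirichletCharacter ℂ f₁) (ψ : DirichletCharacter ℂ f₂)
    (e m n : ℤ) (he : IsCoprime e f₂) :
    eisensteinCoeff χ₁ ψ ![((e * m : ℤ) : ZMod (f₁ * f₂)), (n : ZMod (f₁ * f₂))] =
      χ₁ (e : ZMod f₁) *
        eisensteinCoeff χ₁ ψ ![(m : ZMod (f₁ * f₂)), (n : ZMod (f₁ * f₂))] := by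
  rw [eisensteinCoeff_intCast, eisensteinCoeff_intCast, ← mul_assoc]
  congr 1
  by_cases h : (f₂ : ℤ) ∣ m
  · rw [if_pos h, if_pos (h.mul_left e), Int.mul_ediv_assoc _ h, Int.cast_mul, map_mul]
  · rw [if_neg h, if_neg (fun h' ↦ h (he.symm.dvd_of_dvd_mul_left h')), mul_zero]

theorem DirichletCharacter.exists_coprime_apply_ne_one {f : ℕ} [NeZero f]
    {φ : DirichletCharacter ℂ f} (hφ : φ.IsPrimitive) (hf : 1 < f) {N : ℕ} [NeZero N]
    (hfN : f ∣ N) : ∃ u : (ZMod N)ˣ, φ (((u : ZMod N).cast : ℤ) : ZMod f) ≠ 1 := by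
  have h1 : φ ≠ 1 := by
    rw [Ne, DirichletCharacter.eq_one_iff_conductor_eq_one, (hφ : φ.conductor = f)]
    omega
  obtain ⟨a, ha⟩ := MulChar.ne_one_iff.mp h1
  obtain ⟨u, rfl⟩ := ZMod.unitsMap_surjective hfN a
  refine ⟨u, ?_⟩
  convert ha using 2
  simp [ZMod.unitsMap_val]

/-- One of the characters is non-trivial. Multiplying its coordinate by a unit modulo `f₁ f₂` where
it is not `1` permutes the terms and scales the sum by that value. This is the cancellation required
in weight two. -/
theorem sum_eisensteinCoeff_eq_zero [NeZero f₁] {χ₁ : DirichletCharacter ℂ f₁}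
    {ψ : DirichletCharacter ℂ f₂} (hχ₁ : χ₁.IsPrimitive) (hψ : ψ.IsPrimitive)
    (h : 1 < f₁ * f₂) : ∑ x, eisensteinCoeff χ₁ ψ x = 0 := by
  rw [← (finTwoArrowEquiv (ZMod (f₁ * f₂))).symm.sum_comp, Fintype.sum_prod_type]
  simp only [finTwoArrowEquiv_symm_apply]
  by_cases h₁ : 1 < f₁
  · obtain ⟨u, hu⟩ := DirichletCharacter.exists_coprime_apply_ne_one hχ₁ h₁ (Dvd.intro f₂ rfl)
    rw [Finset.sum_comm]
    refine Finset.sum_eq_zero fun d _ ↦ ?_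
    have hco : IsCoprime ((u : ZMod (f₁ * f₂)).cast : ℤ) f₂ := by
      have h1 : IsCoprime ((f₁ * f₂ : ℕ) : ℤ) ((u : ZMod (f₁ * f₂)).cast : ℤ) := by
        rw [← ZMod.coe_int_isUnit_iff_isCoprime]
        simp
      exact (h1.of_isCoprime_of_dvd_left (by exact_mod_cast Dvd.intro_left f₁ rfl)).symm
    have key : ∑ m, eisensteinCoeff χ₁ ψ ![m, d] =
        χ₁ (((u : ZMod (f₁ * f₂)).cast : ℤ) : ZMod f₁) * ∑ m, eisensteinCoeff χ₁ ψ ![m, d] := by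
      conv_lhs => rw [← Equiv.sum_comp (Units.mulLeft u)]
      rw [Finset.mul_sum]
      refine Finset.sum_congr rfl fun m _ ↦ ?_
      have := eisensteinCoeff_mul_intCast χ₁ ψ (u : ZMod (f₁ * f₂)).cast m.cast d.cast hco
      simpa using this
    have := sub_eq_zero.mpr key
    rw [← one_sub_mul] at this
    exact (mul_eq_zero.mp this).resolve_left (sub_ne_zero.mpr hu.symm)
  · have h₂ : 1 < f₂ := by
      have : f₁ = 1 := by have := NeZero.pos f₁; omega
      rwa [this, one_mul] at h
    obtain ⟨u, hu⟩ := DirichletCharacter.exists_coprime_apply_ne_one hψ h₂ (Dvd.intro_left f₁ rfl)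
    refine Finset.sum_eq_zero fun m _ ↦ ?_
    have key : ∑ d, eisensteinCoeff χ₁ ψ ![m, d] =
        ψ (((u : ZMod (f₁ * f₂)).cast : ℤ) : ZMod f₂) * ∑ d, eisensteinCoeff χ₁ ψ ![m, d] := by
      conv_lhs => rw [← Equiv.sum_comp (Units.mulLeft u)]
      rw [Finset.mul_sum]
      refine Finset.sum_congr rfl fun d _ ↦ ?_
      have h1 := eisensteinCoeff_intCast χ₁ ψ m.cast ((u : ZMod (f₁ * f₂)).cast * d.cast)
      have h2 := eisensteinCoeff_intCast χ₁ ψ m.cast d.cast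
      simp only [Int.cast_mul, ZMod.intCast_cast, ZMod.cast_id', id, map_mul] at h1 h2
      rw [Units.mulLeft_apply, h1, h2]
      simp only [ZMod.intCast_cast]
      ring
    have := sub_eq_zero.mpr key
    rw [← one_sub_mul] at this
    exact (mul_eq_zero.mp this).resolve_left (sub_ne_zero.mpr hu.symm)

theorem DirichletCharacter.apply_zero {f : ℕ} (φ : DirichletCharacter ℂ f) :
    φ 0 = if f = 1 then 1 else 0 := by
  split_ifs with h
  · subst h
    have : (0 : ZMod 1) = 1 := Subsingleton.elim _ _
    rw [this, map_one]
  · exact φ.map_nonunit (by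
      rw [isUnit_zero_iff]
      intro h0
      have : (1 : ZMod f) = 0 := h0.symm
      exact h (ZMod.one_eq_zero_iff.mp this))

theorem DirichletCharacter.eq_one_iff_level_eq_one {f : ℕ} [NeZero f]
    {φ : DirichletCharacter ℂ f} (hφ : φ.IsPrimitive) : φ = 1 ↔ f = 1 := by
  rw [DirichletCharacter.eq_one_iff_conductor_eq_one, (hφ : φ.conductor = f)]

theorem sum_eisensteinCoeff_mul [NeZero f₁] {k : ℕ} (hk : 2 ≤ k) (χ₁ : DirichletCharacter ℂ f₁)
    (ψ : DirichletCharacter ℂ f₂) (m : ℤ) (w : ℂ) :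
    ∑ d : ZMod (f₁ * f₂), eisensteinCoeff χ₁ ψ ![(m : ZMod (f₁ * f₂)), d] *
      inversePowerSum k (f₁ * f₂) w d.cast =
    (if (f₂ : ℤ) ∣ m then χ₁ ((m / f₂ : ℤ) : ZMod f₁) else 0) * characterPowerSum k ψ w := by
  rw [← sum_character_mul_inversePowerSum (Dvd.intro_left f₁ rfl) hk, Finset.mul_sum]
  refine Finset.sum_congr rfl fun d _ ↦ ?_
  have := eisensteinCoeff_intCast χ₁ ψ m d.cast
  simp only [ZMod.intCast_cast, ZMod.cast_id', id] at this
  rw [this, ZMod.intCast_cast, mul_assoc]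

theorem hasSum_characterPowerSum [NeZero f₁] {k : ℕ} (hk : 2 ≤ k) (χ₁ : DirichletCharacter ℂ f₁)
    (ψ : DirichletCharacter ℂ f₂) (z : UpperHalfPlane) :
    HasSum (fun j : ℤ ↦ χ₁ (j : ZMod f₁) * characterPowerSum k ψ (((f₂ * j : ℤ) : ℂ) * z))
      (weightedLatticeSum k (f₁ * f₂) (eisensteinCoeff χ₁ ψ) z) := by
  have hf₂ : (f₂ : ℤ) ≠ 0 := Nat.cast_ne_zero.mpr (NeZero.ne f₂)
  have h := weightedLatticeSum_eq_tsum hk (f₁ * f₂) (eisensteinCoeff χ₁ ψ) z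
  simp_rw [sum_eisensteinCoeff_mul hk] at h
  have hinj : Function.Injective fun j : ℤ ↦ (f₂ : ℤ) * j := mul_right_injective₀ hf₂
  rw [← hinj.hasSum_iff] at h
  · refine (congrArg (HasSum · _) (funext fun j ↦ ?_)).mp h
    simp only [Function.comp, dvd_mul_right, if_true, Int.mul_ediv_cancel_left _ hf₂]
  · intro m hm
    rw [if_neg, zero_mul]
    rintro ⟨c, rfl⟩
    exact hm ⟨c, rfl⟩

open Complex Classical in
/-- The Eisenstein series as a lattice sum. -/
theorem weightedLatticeSum_eisensteinCoeff [NeZero f₁] {k : ℕ} (hk : 2 ≤ k)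
    {χ₁ : DirichletCharacter ℂ f₁} {χ₂ : DirichletCharacter ℂ f₂} (hχ₁ : χ₁.IsPrimitive)
    (hχ₂ : χ₂.IsPrimitive) (hpar : χ₁ (-1) * χ₂ (-1) = (-1) ^ k) (z : UpperHalfPlane) :
    weightedLatticeSum k (f₁ * f₂) (eisensteinCoeff χ₁ χ₂⁻¹) z =
      2 * (((f₂ : ℂ) ^ k)⁻¹ * ((-2 * Real.pi * I) ^ k / (k - 1).factorial) * gaussW χ₂⁻¹) *
        eisensteinE k χ₁ χ₂ z := by
  have hψ := DirichletCharacter.isPrimitive_inv hχ₂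
  have hpar2 : χ₂⁻¹ (-1) = χ₂ (-1) := by
    rw [MulChar.inv_apply_eq_inv']
    rcases χ₂.even_or_odd with h | h <;> rw [h] <;> norm_num
  have hs := hasSum_characterPowerSum hk χ₁ χ₂⁻¹ z
  rw [← hs.tsum_eq, tsum_int_eq_zero_add_tsum_pnat hs.summable]
  -- By parity the rows `j` and `-j` agree, which accounts for the factor `2`.
  have hneg (j : ℕ+) : χ₁ ((-(j : ℕ) : ℤ) : ZMod f₁) *
      characterPowerSum k χ₂⁻¹ (((f₂ * (-(j : ℕ) : ℤ) : ℤ) : ℂ) * z) =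
      χ₁ (((j : ℕ) : ℤ) : ZMod f₁) *
        characterPowerSum k χ₂⁻¹ (((f₂ * ((j : ℕ) : ℤ) : ℤ) : ℂ) * z) := by
    have e1 : ((-(j : ℕ) : ℤ) : ZMod f₁) = -1 * ((j : ℕ) : ℤ) := by push_cast; ring
    have e2 : ((f₂ * (-(j : ℕ) : ℤ) : ℤ) : ℂ) * z = -(((f₂ * ((j : ℕ) : ℤ) : ℤ) : ℂ) * z) := by
      push_cast; ring
    have e3 : χ₁ (-1) * χ₂ (-1) * (-1) ^ k = 1 := by rw [hpar, ← mul_pow]; simp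
    rw [e1, e2, characterPowerSum_neg, map_mul, hpar2]
    linear_combination (χ₁ (((j : ℕ) : ℤ) : ZMod f₁) *
        characterPowerSum k χ₂⁻¹ (((f₂ * ((j : ℕ) : ℤ) : ℤ) : ℂ) * z)) * e3
  simp_rw [hneg, characterPowerSum_eq_tsum_exp hk hψ, inv_inv]
  set A := ((f₂ : ℂ) ^ k)⁻¹ * ((-2 * Real.pi * I) ^ k / (k - 1).factorial) * gaussW χ₂⁻¹ with hA
  have hsum : ∑' j : ℕ+, χ₁ (((j : ℕ) : ℤ) : ZMod f₁) * (A * ∑' l : ℕ+, χ₂ ((l : ℕ) : ZMod f₂) *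
      (l : ℂ) ^ (k - 1) * cexp (2 * Real.pi * I * z) ^ (j * l : ℕ)) =
      A * ∑' n : ℕ+, twistedSigma χ₁ χ₂ k n * cexp (2 * Real.pi * I * ((n : ℕ) : ℂ) * z) := by
    simp_rw [mul_left_comm _ A, tsum_mul_left, ← tsum_mul_left (a := χ₁ _), Int.cast_natCast]
    rw [tsum_tsum_eq_tsum_twistedSigma k χ₁ χ₂ (UpperHalfPlane.norm_exp_two_pi_I_lt_one z)]
    congr 1
    refine tsum_congr fun n ↦ ?_
    rw [← exp_nat_mul]
    congr 2
    ring
  rw [hsum, eisensteinE]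
  -- The row `j = 0` survives only if `χ₁ 0 ≠ 0`, that is `f₁ = 1`; the `L`-value formula then
  -- produces exactly the Bernoulli constant term.
  have hconst : χ₁ 0 * characterPowerSum k χ₂⁻¹ 0 =
      2 * A * (-(if χ₁ = 1 then 1 else 0) * (genBernoulli χ₂ k / (2 * (k : ℂ)))) := by
    rw [DirichletCharacter.apply_zero]
    by_cases h : f₁ = 1
    · have h1 := (DirichletCharacter.eq_one_iff_level_eq_one hχ₁).mpr h
      have hpar1 : χ₂⁻¹ (-1) = (-1) ^ k := by
        rw [hpar2, ← hpar, h1, MulChar.one_apply isUnit_one.neg, one_mul]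
      rw [if_pos h, if_pos h1, characterPowerSum_zero hk _ hpar1,
        LSeries_eq_genBernoulli hψ hk hpar1, inv_inv, hA]
      have : (k.factorial : ℂ) = k * (k - 1).factorial := by
        exact_mod_cast (Nat.mul_factorial_pred (by omega)).symm
      rw [this]
      have : (k : ℂ) ≠ 0 := by norm_cast; omega
      have : ((k - 1).factorial : ℂ) ≠ 0 := by exact_mod_cast (k - 1).factorial_ne_zero
      field_simp
    · rw [if_neg h, if_neg (fun h1 ↦ h ((DirichletCharacter.eq_one_iff_level_eq_one hχ₁).mp h1))]
      simp
  simp only [Int.cast_zero, mul_zero, zero_mul] at *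
  rw [hconst]
  by_cases h1 : χ₁ = 1 <;> simp only [h1, if_true, if_false] <;> ring

end

/-! ### The constant term of the Eisenstein series at an arbitrary cusp. -/

noncomputable section

open Filter

theorem DirichletCharacter.changeLevel_natCast_of_eq {a b : ℕ} (h : a = b)
    (φ : DirichletCharacter ℂ a) (n : ℕ) :
    DirichletCharacter.changeLevel (dvd_of_eq h) φ (n : ZMod b) = φ (n : ZMod a) := by
  subst h
  rw [DirichletCharacter.changeLevel_self]

theorem DirichletCharacter.primitiveCharacter_inv_natCast {m : ℕ} [NeZero m]
    (φ : DirichletCharacter ℂ m) (n : ℕ) :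
    φ⁻¹.primitiveCharacter (n : ZMod _) = (φ.primitiveCharacter)⁻¹ (n : ZMod _) := by
  rw [← DirichletCharacter.changeLevel_natCast_of_eq φ.conductor_inv]
  congr 1
  refine DirichletCharacter.changeLevel_injective φ.conductor_dvd_level ?_
  rw [← DirichletCharacter.changeLevel_trans, DirichletCharacter.changeLevel_primitiveCharacter,
    map_inv, DirichletCharacter.changeLevel_primitiveCharacter]

theorem DirichletCharacter.inv_mul_eq {m n : ℕ} (φ : DirichletCharacter ℂ m)
    (ψ : DirichletCharacter ℂ n) : φ⁻¹.mul ψ = (φ.mul ψ⁻¹)⁻¹ := by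
  rw [DirichletCharacter.mul, DirichletCharacter.mul, mul_inv, map_inv, map_inv, inv_inv]

theorem DirichletCharacter.conductor_inv_mul {m n : ℕ} (φ : DirichletCharacter ℂ m)
    (ψ : DirichletCharacter ℂ n) : (φ⁻¹.mul ψ).conductor = (φ.mul ψ⁻¹).conductor := by
  rw [DirichletCharacter.inv_mul_eq, DirichletCharacter.conductor_inv]

theorem genBernoulli_primitive_mul_inv {m n : ℕ} [NeZero m] [NeZero n]
    (φ : DirichletCharacter ℂ m) (ψ : DirichletCharacter ℂ n) (k : ℕ) :
    genBernoulli (φ⁻¹.primitive_mul ψ) k = genBernoulli (φ.primitive_mul ψ⁻¹)⁻¹ k := by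
  refine genBernoulli_congr _ _ (DirichletCharacter.conductor_inv_mul φ ψ) (fun j ↦ ?_) k
  rw [DirichletCharacter.primitive_mul, DirichletCharacter.primitive_mul,
    ← DirichletCharacter.primitiveCharacter_inv_natCast]
  congr 1 <;> rw [DirichletCharacter.inv_mul_eq]

theorem DirichletCharacter.conductor_mul_dvd_mul {m n : ℕ} (φ : DirichletCharacter ℂ m)
    (ψ : DirichletCharacter ℂ n) : (φ.mul ψ).conductor ∣ m * n :=
  (φ.mul ψ).conductor_dvd_level.trans (Nat.lcm_dvd_mul m n)

/-- Raising the level to `m * n` puts back the zeros of the product at all primes dividing `m * n`.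
This is the source of the Euler factors in the final formula. -/
theorem DirichletCharacter.changeLevel_primitive_mul_intCast {m n : ℕ}
    (φ : DirichletCharacter ℂ m) (ψ : DirichletCharacter ℂ n) (t : ℤ) :
    DirichletCharacter.changeLevel (φ.conductor_mul_dvd_mul ψ) (φ.primitive_mul ψ)
      (t : ZMod (m * n)) = φ (t : ZMod m) * ψ (t : ZMod n) := by
  by_cases ht : IsUnit (t : ZMod (m * n))
  · have ht' := ((ZMod.coe_int_isUnit_iff_isCoprime t (m * n)).mp ht).symm
    rw [DirichletCharacter.primitive_mul, DirichletCharacter.changeLevel_trans _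
      (φ.mul ψ).conductor_dvd_level (Nat.lcm_dvd_mul m n),
      DirichletCharacter.changeLevel_primitiveCharacter, DirichletCharacter.mul, map_mul,
      ← DirichletCharacter.changeLevel_trans, ← DirichletCharacter.changeLevel_trans,
      MulChar.mul_apply, DirichletCharacter.changeLevel_eq_cast_of_dvd' _ (Dvd.intro n rfl) ht',
      DirichletCharacter.changeLevel_eq_cast_of_dvd' _ (Dvd.intro_left m rfl) ht']
  · rw [MulChar.map_nonunit _ ht]
    rw [ZMod.coe_int_isUnit_iff_isCoprime, Nat.cast_mul, IsCoprime.mul_left_iff, not_and_or] at ht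
    rcases ht with h | h
    · rw [φ.map_nonunit (by rwa [ZMod.coe_int_isUnit_iff_isCoprime]), zero_mul]
    · rw [ψ.map_nonunit (by rwa [ZMod.coe_int_isUnit_iff_isCoprime]), mul_zero]

theorem primitive_mul_neg_one {f₁ f₂ k : ℕ} (χ : DirichletCharacter ℂ f₁)
    (ψ : DirichletCharacter ℂ f₂) (hpar : χ (-1) * ψ (-1) = (-1) ^ k) :
    χ.primitive_mul ψ (-1) = (-1) ^ k := by
  have h := DirichletCharacter.changeLevel_primitive_mul_intCast χ ψ (-1)
  rw [DirichletCharacter.changeLevel_eq_cast_of_dvd' _ _ isCoprime_one_left.neg_left] at h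
  simpa [hpar] using h

variable {f₁ f₂ : ℕ} [NeZero f₁] [NeZero f₂]

theorem tsum_character_mul_character {k : ℕ} (hk : 2 ≤ k) (χ : DirichletCharacter ℂ f₁)
    (ψ : DirichletCharacter ℂ f₂) (hpar : χ (-1) * ψ (-1) = (-1) ^ k) :
    ∑' t : ℤ, χ (t : ZMod f₁) * ψ (t : ZMod f₂) * ((t : ℂ) ^ k)⁻¹ =
      2 * LSeries (fun n ↦ χ.primitive_mul ψ (n : ZMod _)) k *
        ∏ p ∈ (f₁ * f₂).primeFactors, (1 - χ.primitive_mul ψ (p : ZMod _) * ((p : ℂ) ^ k)⁻¹) := by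
  have h1 := DirichletCharacter.changeLevel_primitive_mul_intCast χ ψ
  have h := h1 (-1)
  simp only [Int.cast_neg, Int.cast_one, hpar] at h
  simp_rw [← h1]
  rw [(hasSum_int_character_div_pow _ hk h).tsum_eq, LSeries_changeLevel_natCast _ _ hk, mul_assoc]

/-- The normalizing factor between the Eisenstein series and the corresponding lattice sum. -/
def eisensteinScale {f : ℕ} [NeZero f] (k : ℕ) (χ : DirichletCharacter ℂ f) : ℂ :=
  2 * (((f : ℂ) ^ k)⁻¹ * ((-2 * Real.pi * Complex.I) ^ k / (k - 1).factorial) * gaussW χ⁻¹)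

theorem eisensteinScale_ne_zero {f : ℕ} [NeZero f] (k : ℕ) {χ : DirichletCharacter ℂ f}
    (hχ : χ.IsPrimitive) : eisensteinScale k χ ≠ 0 := by
  have hf : (f : ℂ) ≠ 0 := Nat.cast_ne_zero.mpr (NeZero.ne f)
  have h1 := gaussW_ne_zero (DirichletCharacter.isPrimitive_inv hχ)
  have h2 : ((k - 1).factorial : ℂ) ≠ 0 := by exact_mod_cast (k - 1).factorial_ne_zero
  have h3 : (-2 * Real.pi * Complex.I : ℂ) ≠ 0 := by simp [Real.pi_ne_zero]
  rw [eisensteinScale]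
  exact mul_ne_zero two_ne_zero (mul_ne_zero (mul_ne_zero (inv_ne_zero (pow_ne_zero k hf))
    (div_ne_zero (pow_ne_zero k h3) h2)) h1)

/-- Since `(0, t)γ⁻¹ = (-tv, tu)`, the dependence on `t` splits off multiplicatively when `f₂ ∣ v`.
-/
theorem sum_eisensteinCoeff_comp_rowEquiv_symm {k : ℕ} (hk : 2 ≤ k) (χ : DirichletCharacter ℂ f₁)
    (ψ : DirichletCharacter ℂ f₂) (γ : SL(2, ℤ)) :
    ∑ d : ZMod (f₁ * f₂), (eisensteinCoeff χ ψ ∘ (rowEquiv (ZMod (f₁ * f₂)) γ).symm) ![0, d] *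
      inversePowerSum k (f₁ * f₂) 0 d.cast =
    if (f₂ : ℤ) ∣ γ 1 0 then
      χ ((-(γ 1 0 / f₂) : ℤ) : ZMod f₁) * ψ ((γ 0 0 : ℤ) : ZMod f₂) *
        ∑' t : ℤ, χ (t : ZMod f₁) * ψ (t : ZMod f₂) * ((t : ℂ) ^ k)⁻¹
    else 0 := by
  have hf₂ : (f₂ : ℤ) ≠ 0 := Nat.cast_ne_zero.mpr (NeZero.ne f₂)
  have hval (t : ℤ) : (eisensteinCoeff χ ψ ∘ (rowEquiv (ZMod (f₁ * f₂)) γ).symm) ![0, t] =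
      (if (f₂ : ℤ) ∣ γ 1 0 then χ ((-(γ 1 0 / f₂) : ℤ) : ZMod f₁) *
        ψ ((γ 0 0 : ℤ) : ZMod f₂) else 0) * (χ (t : ZMod f₁) * ψ (t : ZMod f₂)) := by
    have e : (rowEquiv (ZMod (f₁ * f₂)) γ).symm ![0, (t : ZMod (f₁ * f₂))] =
        ![((-(t * γ 1 0) : ℤ) : ZMod (f₁ * f₂)), ((t * γ 0 0 : ℤ) : ZMod (f₁ * f₂))] := by
      simp [rowEquiv_symm_apply]
    rw [Function.comp, e, eisensteinCoeff_intCast]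
    by_cases h : (f₂ : ℤ) ∣ γ 1 0
    · obtain ⟨c, hc⟩ := h
      have h1 : -(t * (f₂ * c)) = f₂ * (-c * t) := by ring
      rw [hc, h1, if_pos (dvd_mul_right _ _), if_pos (dvd_mul_right _ _),
        Int.mul_ediv_cancel_left _ hf₂, Int.mul_ediv_cancel_left _ hf₂, Int.cast_mul, Int.cast_mul,
        map_mul, map_mul]
      ring
    · rw [if_neg h, zero_mul]
      -- If `f₂ ∤ v`, either `t` is prime to `f₂` and `f₂ ∤ tv`, or `ψ(t) = 0`.
      by_cases ht : IsCoprime (f₂ : ℤ) t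
      · rw [if_neg, zero_mul]
        rw [dvd_neg]
        exact fun h' ↦ h (ht.dvd_of_dvd_mul_left h')
      · rw [Int.cast_mul, map_mul, ψ.map_nonunit (a := (t : ZMod f₂))
          (by rwa [ZMod.coe_int_isUnit_iff_isCoprime]), zero_mul, mul_zero]
  set a := eisensteinCoeff χ ψ ∘ (rowEquiv (ZMod (f₁ * f₂)) γ).symm with ha
  have hsum : Summable fun t : ℤ ↦ a ![0, t] * ((t : ℂ) ^ k)⁻¹ := by
    refine Summable.of_norm_bounded (g := fun t : ℤ ↦ (∑ x, ‖a x‖) * ‖((t : ℂ) ^ k)⁻¹‖) ?_ ?_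
    · simpa using (summable_inv_add_pow hk 0).norm.mul_left (∑ x, ‖a x‖)
    · intro t
      rw [norm_mul]
      exact mul_le_mul_of_nonneg_right (Finset.single_le_sum (f := fun x ↦ ‖a x‖)
        (fun x _ ↦ norm_nonneg _) (Finset.mem_univ _)) (norm_nonneg _)
  have key := Int.sum_tsum_residue_classes hsum (f₁ * f₂)
  have hl (d : ZMod (f₁ * f₂)) : ∑' m : ℤ, a ![0, (((f₁ * f₂ : ℕ) * m + (d.cast : ℤ) : ℤ) :
      ZMod (f₁ * f₂))] * ((((f₁ * f₂ : ℕ) * m + (d.cast : ℤ) : ℤ) : ℂ) ^ k)⁻¹ =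
      a ![0, d] * inversePowerSum k (f₁ * f₂) 0 d.cast := by
    rw [inversePowerSum, ← tsum_mul_left]
    refine tsum_congr fun m ↦ ?_
    have hd : ((((f₁ * f₂ : ℕ) : ℤ) * m + (d.cast : ℤ) : ℤ) : ZMod (f₁ * f₂)) = d := by
      rw [Int.cast_add, Int.cast_mul, Int.cast_natCast, ZMod.natCast_self, zero_mul, zero_add,
        ZMod.intCast_cast, ZMod.cast_id', id]
    rw [zero_add, hd]
  simp_rw [hl, hval, mul_assoc] at key
  rw [key, tsum_mul_left]
  split_ifs <;> simp [mul_assoc]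

theorem tendsto_eisensteinE_smul {k : ℕ} (hk : 2 ≤ k) {χ₁ : DirichletCharacter ℂ f₁}
    {χ₂ : DirichletCharacter ℂ f₂} (hχ₁ : χ₁.IsPrimitive) (hχ₂ : χ₂.IsPrimitive)
    (hpar : χ₁ (-1) * χ₂ (-1) = (-1) ^ k) (hNk : 1 < f₁ * f₂ ∨ 2 < k) (γ : SL(2, ℤ)) :
    Tendsto (fun z : UpperHalfPlane ↦ (UpperHalfPlane.denom γ z ^ k)⁻¹ *
      eisensteinE k χ₁ χ₂ (γ • z)) UpperHalfPlane.atImInfty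
      (nhds ((eisensteinScale k χ₂)⁻¹ * if (f₂ : ℤ) ∣ γ 1 0 then
        χ₁ ((-(γ 1 0 / f₂) : ℤ) : ZMod f₁) * χ₂⁻¹ ((γ 0 0 : ℤ) : ZMod f₂) *
          ∑' t : ℤ, χ₁ (t : ZMod f₁) * χ₂⁻¹ (t : ZMod f₂) * ((t : ℂ) ^ k)⁻¹
      else 0)) := by
  have hψ := DirichletCharacter.isPrimitive_inv hχ₂
  have hsum : ∑ x, eisensteinCoeff χ₁ χ₂⁻¹ x = 0 ∨ 3 ≤ k :=
    hNk.imp (sum_eisensteinCoeff_eq_zero hχ₁ hψ) id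
  rw [← sum_eisensteinCoeff_comp_rowEquiv_symm hk χ₁ χ₂⁻¹ γ]
  refine ((tendsto_weightedLatticeSum hk (f₁ * f₂) _).const_mul _).congr fun z ↦ ?_
  have h := weightedLatticeSum_eisensteinCoeff hk hχ₁ hχ₂ hpar (γ • z)
  have hd : UpperHalfPlane.denom γ z ^ k ≠ 0 := pow_ne_zero k (UpperHalfPlane.denom_ne_zero _ z)
  rw [weightedLatticeSum_smul hk _ hsum, ← eisensteinScale] at h
  rw [eq_inv_mul_iff_mul_eq₀ hd, mul_left_comm, h,
    inv_mul_cancel_left₀ (eisensteinScale_ne_zero k hχ₂)]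

end

/-! ### The degeneracy operator, and evaluation of the constant term. -/

noncomputable section

open Filter UpperHalfPlane

/-- The matrix identity behind this is `diag(M,1) γ = γ' (r, b; 0, M')`, with `w(z) = (rz + b)/M'`.
-/
theorem exists_degeneracy_slash_eq (γ : SL(2, ℤ)) {M r M' : ℕ} [NeZero M] {v' : ℤ}
    (hM : M = M' * r) (hv : γ 1 0 = v' * r) (hco : IsCoprime (M' : ℤ) v') (k : ℕ) :
    ∃ (γ' : SL(2, ℤ)) (w : ℍ → ℍ), γ' 0 0 = M' * γ 0 0 ∧ γ' 1 0 = v' ∧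
      Tendsto w atImInfty atImInfty ∧ ∀ (f : ℍ → ℂ) (z : ℍ),
        (degeneracy M f ∣[(k : ℤ)] γ) z =
          ((M' : ℂ) ^ k)⁻¹ * ((denom γ' (w z) ^ k)⁻¹ * f (γ' • w z)) := by
  have hM0 : M' * r ≠ 0 := hM ▸ NeZero.ne M
  have hM' : 0 < M' := Nat.pos_of_ne_zero (left_ne_zero_of_mul hM0)
  have hr : 0 < r := Nat.pos_of_ne_zero (right_ne_zero_of_mul hM0)
  have hdet : γ 0 0 * γ 1 1 - γ 0 1 * γ 1 0 = 1 := by rw [← Matrix.det_fin_two, γ.det_coe]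
  -- Together with `hco` this makes `(M'u, v')` a primitive column, which can be completed to `γ'`.
  have huv : IsCoprime (γ 0 0) v' := ⟨γ 1 1, -(γ 0 1 * r), by linear_combination hdet + γ 0 1 * hv⟩
  obtain ⟨δ', b', hb⟩ := hco.mul_left huv
  let γ' : SL(2, ℤ) := ⟨!![M' * γ 0 0, -b'; v', δ'], by
    rw [Matrix.det_fin_two_of]; linear_combination hb⟩
  -- The upper right entry of `γ'⁻¹ diag(M,1) γ`.
  let b : ℤ := δ' * M * γ 0 1 + b' * γ 1 1
  have him (z : ℍ) : (((r : ℂ) * z + b) / M').im = r / M' * z.im := by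
    rw [Complex.div_natCast_im]
    simp
    ring
  let w (z : ℍ) : ℍ := ⟨((r : ℂ) * z + b) / M', by
    rw [him]
    exact mul_pos (div_pos (Nat.cast_pos.mpr hr) (Nat.cast_pos.mpr hM')) z.im_pos⟩
  have hw (z : ℍ) : (M' : ℂ) * (w z : ℂ) = r * z + b :=
    mul_div_cancel₀ _ (Nat.cast_ne_zero.mpr hM'.ne')
  have hC : (γ 0 0 : ℂ) * γ 1 1 - γ 0 1 * γ 1 0 = 1 := by exact_mod_cast hdet
  have hvC : (γ 1 0 : ℂ) = v' * r := by exact_mod_cast hv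
  have hMC : (M : ℂ) = M' * r := by exact_mod_cast hM
  have hbC : (δ' : ℂ) * (M' * γ 0 0) + b' * v' = 1 := by exact_mod_cast hb
  have hbb : (b : ℂ) = δ' * M * γ 0 1 + b' * γ 1 1 := by simp only [b]; push_cast; ring
  have hden (z : ℍ) : (M' : ℂ) * (v' * w z + δ') = γ 1 0 * z + γ 1 1 := by
    linear_combination v' * hw z + v' * hbb + (v' * δ' * γ 0 1) * hMC - z * hvC +
      (γ 1 1 : ℂ) * hbC - δ' * M' * hC - δ' * M' * γ 0 1 * hvC
  have hnum (z : ℍ) : (M' : ℂ) * (M' * γ 0 0 * w z - b') = M * (γ 0 0 * z + γ 0 1) := by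
    linear_combination (M' : ℂ) * γ 0 0 * hw z + M' * γ 0 0 * hbb - γ 0 0 * z * hMC +
      M * γ 0 1 * hbC + M' * b' * hC + M' * b' * γ 0 1 * hvC - γ 0 1 * b' * v' * hMC
  refine ⟨γ', w, rfl, rfl, ?_, fun f z ↦ ?_⟩
  · rw [atImInfty, tendsto_comap_iff]
    refine (tendsto_comap.const_mul_atTop (div_pos (Nat.cast_pos.mpr hr)
      (Nat.cast_pos.mpr hM') : (0 : ℝ) < r / M')).congr fun z ↦ (him z).symm
  · have h1 : denom γ z = M' * denom γ' (w z) := by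
      rw [ModularGroup.denom_apply, ModularGroup.denom_apply]
      exact (hden z).symm
    have h2 : (⟨(M : ℂ) * ((γ • z : ℍ) : ℂ), by
        simpa using mul_pos (Nat.cast_pos.mpr (NeZero.pos M) : (0 : ℝ) < M) (γ • z).im_pos⟩ : ℍ) =
        γ' • w z := by
      have hne : (v' : ℂ) * w z + δ' ≠ 0 := denom_ne_zero γ' (w z)
      have hne' : (γ 1 0 : ℂ) * z + γ 1 1 ≠ 0 := denom_ne_zero γ z
      have h3 : ((γ • z : ℍ) : ℂ) = (γ 0 0 * z + γ 0 1) / (γ 1 0 * z + γ 1 1) :=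
        coe_specialLinearGroup_apply γ z
      have h4 : ((γ' • w z : ℍ) : ℂ) =
          (((M' * γ 0 0 : ℤ) : ℂ) * w z + ((-b' : ℤ) : ℂ)) / (v' * w z + δ') :=
        coe_specialLinearGroup_apply γ' (w z)
      apply UpperHalfPlane.ext
      change (M : ℂ) * ((γ • z : ℍ) : ℂ) = _
      rw [h3, h4, ← mul_div_assoc, div_eq_div_iff hne' hne, ← hden, ← hnum]
      push_cast
      ring
    rw [ModularForm.SL_slash_apply, degeneracy, h2, h1, zpow_neg, zpow_natCast, mul_pow, mul_inv]
    ring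


variable {f₁ f₂ : ℕ} [NeZero f₁] [NeZero f₂]

theorem tendsto_slashedEisenstein {k : ℕ} (hk : 2 ≤ k) {χ₁ : DirichletCharacter ℂ f₁}
    {χ₂ : DirichletCharacter ℂ f₂} (hχ₁ : χ₁.IsPrimitive) (hχ₂ : χ₂.IsPrimitive)
    (hpar : χ₁ (-1) * χ₂ (-1) = (-1) ^ k) (hNk : 1 < f₁ * f₂ ∨ 2 < k) (γ : SL(2, ℤ))
    {M r M' : ℕ} [NeZero M] {v' : ℤ} (hM : M = M' * r) (hv : γ 1 0 = v' * r)
    (hco : IsCoprime (M' : ℤ) v') :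
    Tendsto (slashedEisenstein k χ₁ χ₂ M γ) atImInfty
      (nhds (((M' : ℂ) ^ k)⁻¹ * ((eisensteinScale k χ₂)⁻¹ * if (f₂ : ℤ) ∣ v' then
        χ₁ ((-(v' / f₂) : ℤ) : ZMod f₁) * χ₂⁻¹ ((M' * γ 0 0 : ℤ) : ZMod f₂) *
          ∑' t : ℤ, χ₁ (t : ZMod f₁) * χ₂⁻¹ (t : ZMod f₂) * ((t : ℂ) ^ k)⁻¹
      else 0))) := by
  obtain ⟨γ', w, h00, h10, hw, h⟩ := exists_degeneracy_slash_eq γ hM hv hco k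
  rw [← h00, ← h10]
  exact (((tendsto_eisensteinE_smul hk hχ₁ hχ₂ hpar hNk γ').comp hw).const_mul _).congr
    fun z ↦ (h _ z).symm

/-- The determinant makes `u` and `δ` inverse modulo `f`; this is how the `u` of the lattice
computation becomes the `δ` of the final formula. -/
theorem inv_character_apply_eq {f : ℕ} (χ : DirichletCharacter ℂ f) {u β v δ : ℤ}
    (hdet : u * δ - β * v = 1) (hv : (f : ℤ) ∣ v) : χ⁻¹ (u : ZMod f) = χ (δ : ZMod f) := by
  have h : (u : ZMod f) * δ = 1 := by
    have := congrArg (Int.cast : ℤ → ZMod f) hdet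
    rwa [Int.cast_sub, Int.cast_mul, Int.cast_mul, (ZMod.intCast_zmod_eq_zero_iff_dvd v f).mpr hv,
      mul_zero, sub_zero, Int.cast_one] at this
  have hu : IsUnit (u : ZMod f) := IsUnit.of_mul_eq_one _ h
  have h' : χ u * χ δ = 1 := by rw [← map_mul, h, map_one]
  have h'' : χ⁻¹ u * χ u = 1 := by rw [← MulChar.mul_apply, inv_mul_cancel, MulChar.one_apply hu]
  exact left_inv_eq_right_inv h'' h'

theorem inv_character_neg_one {f : ℕ} (χ : DirichletCharacter ℂ f) : χ⁻¹ (-1) = χ (-1) := by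
  simpa using inv_character_apply_eq χ (u := -1) (β := 0) (v := 0) (δ := -1) (by norm_num)
    (dvd_zero _)

/-- The normalized twisted zeta value, expressed through Gauss sums and Bernoulli numbers. -/
theorem eisensteinScale_inv_mul_tsum {k : ℕ} (hk : 2 ≤ k) {χ₁ : DirichletCharacter ℂ f₁}
    {χ₂ : DirichletCharacter ℂ f₂} (hpar : χ₁ (-1) * χ₂ (-1) = (-1) ^ k) :
    (eisensteinScale k χ₂)⁻¹ *
        ∑' t : ℤ, χ₁ (t : ZMod f₁) * χ₂⁻¹ (t : ZMod f₂) * ((t : ℂ) ^ k)⁻¹ =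
      -(((f₂ : ℂ) / (χ₁⁻¹.primitive_mul χ₂).conductor) ^ k *
        (gaussW (χ₁.primitive_mul χ₂⁻¹) / gaussW χ₂⁻¹) *
        (genBernoulli (χ₁⁻¹.primitive_mul χ₂) k / (2 * (k : ℂ))) *
        ∏ p ∈ (f₁ * f₂).primeFactors,
          (1 - χ₁.primitive_mul χ₂⁻¹ (p : ZMod _) * ((p : ℂ) ^ k)⁻¹)) := by
  have hpar' : χ₁ (-1) * χ₂⁻¹ (-1) = (-1) ^ k := by rw [inv_character_neg_one, hpar]
  have hprim := DirichletCharacter.primitive_mul_isPrimitive χ₁ χ₂⁻¹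
  rw [tsum_character_mul_character hk χ₁ χ₂⁻¹ hpar', LSeries_eq_genBernoulli hprim hk
    (primitive_mul_neg_one χ₁ χ₂⁻¹ hpar'), genBernoulli_primitive_mul_inv]
  have hc : (χ₁⁻¹.primitive_mul χ₂).conductor = (χ₁.mul χ₂⁻¹).conductor :=
    (DirichletCharacter.primitive_mul_isPrimitive χ₁⁻¹ χ₂).trans
      (DirichletCharacter.conductor_inv_mul χ₁ χ₂)
  rw [hc, eisensteinScale]
  have hf : (f₂ : ℂ) ≠ 0 := Nat.cast_ne_zero.mpr (NeZero.ne f₂)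
  have hc0 : ((χ₁.mul χ₂⁻¹).conductor : ℂ) ≠ 0 := Nat.cast_ne_zero.mpr (NeZero.ne _)
  have hA : (-2 * Real.pi * Complex.I : ℂ) ≠ 0 := by simp [Real.pi_ne_zero]
  have hk0 : (k : ℂ) ≠ 0 := Nat.cast_ne_zero.mpr (by lia)
  -- The quotient of `k!` from the `L`-value by `(k-1)!` from the scale leaves the `k` in the
  -- denominator `2k`.
  have hfac : (k.factorial : ℂ) = k * (k - 1).factorial := by
    exact_mod_cast (Nat.mul_factorial_pred (by lia)).symm
  have hfac0 : ((k - 1).factorial : ℂ) ≠ 0 := Nat.cast_ne_zero.mpr (Nat.factorial_ne_zero _)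
  rw [hfac]
  generalize (-2 * Real.pi * Complex.I : ℂ) = A at *
  generalize ((k - 1).factorial : ℂ) = q at *
  rw [div_pow]
  field_simp

/-- The `L`-value lies in the region of absolute convergence of its Euler product, and no Euler
factor vanishes because `|φ(p) p^(-k)| < 1`. -/
theorem tsum_character_mul_character_ne_zero {k : ℕ} (hk : 2 ≤ k) {χ : DirichletCharacter ℂ f₁}
    {ψ : DirichletCharacter ℂ f₂} (hpar : χ (-1) * ψ (-1) = (-1) ^ k) :
    ∑' t : ℤ, χ (t : ZMod f₁) * ψ (t : ZMod f₂) * ((t : ℂ) ^ k)⁻¹ ≠ 0 := by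
  rw [tsum_character_mul_character hk χ ψ hpar]
  refine mul_ne_zero (mul_ne_zero two_ne_zero ?_) (Finset.prod_ne_zero_iff.mpr fun p hp ↦
    one_sub_character_mul_ne_zero _ (by lia) (Nat.prime_of_mem_primeFactors hp))
  refine DirichletCharacter.LSeries_ne_zero_of_one_lt_re _ ?_
  rw [Complex.natCast_re]
  exact_mod_cast hk

theorem character_intCast_ne_zero_iff {f : ℕ} (χ : DirichletCharacter ℂ f) (t : ℤ) :
    χ (t : ZMod f) ≠ 0 ↔ Int.gcd t f = 1 := by
  rw [← Int.isCoprime_iff_gcd_eq_one, isCoprime_comm, ← ZMod.coe_int_isUnit_iff_isCoprime]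
  exact ⟨fun h ↦ by_contra fun h' ↦ h (χ.map_nonunit h'), fun h ↦ (h.map χ).ne_zero⟩

theorem isOfFinOrder_character {f : ℕ} [NeZero f] (χ : DirichletCharacter ℂ f) {t : ZMod f}
    (h : χ t ≠ 0) : IsOfFinOrder (χ t) := by
  have hu : IsUnit t := by_contra fun h' ↦ h (χ.map_nonunit h')
  exact MonoidHom.isOfFinOrder (χ : ZMod f →* ℂ)
    (isOfFinOrder_iff_isUnit.mpr hu)

theorem isAlgebraic_prod {ι : Type*} (s : Finset ι) {F : ι → ℂ}
    (h : ∀ i ∈ s, IsAlgebraic ℚ (F i)) : IsAlgebraic ℚ (∏ i ∈ s, F i) := by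
  simp_rw [← mem_algebraicClosure_iff] at h ⊢
  exact prod_mem h

end

/-! ### The main theorem. -/

theorem proposition1 (k : ℕ) (hk : 2 ≤ k)
    (f₁ f₂ : ℕ) [NeZero f₁] [NeZero f₂]
    (χ₁ : DirichletCharacter ℂ f₁) (χ₂ : DirichletCharacter ℂ f₂)
    (hχ₁ : χ₁.IsPrimitive) (hχ₂ : χ₂.IsPrimitive)
    (hparity : χ₁ (-1) * χ₂ (-1) = (-1) ^ k)
    (hNk : 1 < f₁ * f₂ ∨ 2 < k)
    (u β v δ : ℤ) (γ : SL(2, ℤ))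
    (hγ : (γ : Matrix (Fin 2) (Fin 2) ℤ) = !![u, β; v, δ])
    (M : ℕ) [NeZero M] (r M' : ℕ) (v' : ℤ)
    (hr : r = Int.gcd v M) (hv' : v' = v / r) (hM' : M' = M / r) :
    -- the limit defining the constant term exists
    Filter.Tendsto (slashedEisenstein k χ₁ χ₂ M γ) UpperHalfPlane.atImInfty
      (nhds (Upsilon k χ₁ χ₂ γ M)) ∧
    (¬ (f₂ : ℤ) ∣ v' → Upsilon k χ₁ χ₂ γ M = 0) ∧
    ((f₂ : ℤ) ∣ v' →
      (Upsilon k χ₁ χ₂ γ M ≠ 0 ↔ Int.gcd (v' / f₂) f₁ = 1) ∧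
      (Int.gcd (v' / f₂) f₁ = 1 →
        ∃ ξ : ℂ,
          ξ = -χ₂ (δ : ZMod f₂) * star χ₂ (M' : ZMod f₂) *
            χ₁ ((-(v' / f₂) : ℤ) : ZMod f₁) ∧
          (∃ n : ℕ, 0 < n ∧ ξ ^ n = 1) ∧
          IsAlgebraic ℚ (Upsilon k χ₁ χ₂ γ M) ∧
          Upsilon k χ₁ χ₂ γ M =
            ξ * ((f₂ : ℂ) / ((M' : ℂ) * (((star χ₁).primitive_mul χ₂).conductor : ℂ))) ^ k *
              (gaussW (χ₁.primitive_mul (star χ₂)) / gaussW (star χ₂)) *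
              (genBernoulli ((star χ₁).primitive_mul χ₂) k / (2 * (k : ℂ))) *
              ∏ p ∈ (f₁ * f₂).primeFactors,
                (1 - χ₁.primitive_mul (star χ₂) (p : ZMod _) * ((p : ℂ) ^ k)⁻¹))) := by
  have h00 : γ 0 0 = u := by rw [hγ]; rfl
  have h10 : γ 1 0 = v := by rw [hγ]; rfl
  have hdet : u * δ - β * v = 1 := by
    rw [← Matrix.det_fin_two_of, ← hγ, γ.det_coe]
  have hr0 : r ≠ 0 := by
    rw [hr, Ne, Int.gcd_eq_zero_iff]
    exact fun h ↦ NeZero.ne M (by exact_mod_cast h.2)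
  have hrv : v = v' * r := by
    rw [hv', Int.ediv_mul_cancel (hr ▸ Int.gcd_dvd_left v M)]
  have hrM : M = M' * r := by
    have : (r : ℤ) ∣ M := hr ▸ Int.gcd_dvd_right v M
    rw [hM', Nat.div_mul_cancel (by exact_mod_cast this)]
  have hM0 : M' ≠ 0 := fun h ↦ NeZero.ne M (by rw [hrM, h, zero_mul])
  have hco : IsCoprime (M' : ℤ) v' := by
    have hrM' : (M' : ℤ) = M / r := by rw [hM', Int.natCast_div]
    rw [isCoprime_comm, Int.isCoprime_iff_gcd_eq_one, hrM', hv', hr]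
    exact Int.gcd_ediv_gcd_ediv_gcd (Nat.pos_of_ne_zero (hr ▸ hr0))
  have hlim := tendsto_slashedEisenstein hk hχ₁ hχ₂ hparity hNk γ hrM (h10.trans hrv) hco
  -- `Upsilon` is a `limUnder`, so its value is known only once convergence has been proved.
  have hU : Upsilon k χ₁ χ₂ γ M = _ := hlim.limUnder_eq
  rw [← hU] at hlim
  refine ⟨hlim, fun h ↦ by rw [hU, if_neg h, mul_zero, mul_zero], fun h ↦ ?_⟩
  have hfv : (f₂ : ℤ) ∣ v := hrv ▸ h.mul_right _
  have hδ : χ₂ (δ : ZMod f₂) ≠ 0 := by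
    rw [character_intCast_ne_zero_iff, ← Int.isCoprime_iff_gcd_eq_one]
    obtain ⟨c, hc⟩ := hfv
    exact ⟨u, -(β * c), by linear_combination hdet + β * hc⟩
  have hM'χ : χ₂⁻¹ (M' : ZMod f₂) ≠ 0 := by
    have := (character_intCast_ne_zero_iff χ₂⁻¹ M').mpr
      (Int.isCoprime_iff_gcd_eq_one.mp (hco.of_isCoprime_of_dvd_right h))
    rwa [Int.cast_natCast] at this
  have hpar' : χ₁ (-1) * χ₂⁻¹ (-1) = (-1) ^ k := by rw [inv_character_neg_one, hparity]
  rw [if_pos h, h00, Int.cast_mul, map_mul, Int.cast_natCast,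
    inv_character_apply_eq χ₂ hdet hfv] at hU
  have hM'C : (M' : ℂ) ≠ 0 := Nat.cast_ne_zero.mpr hM0
  have hχ : χ₁ ((-(v' / f₂) : ℤ) : ZMod f₁) ≠ 0 ↔ Int.gcd (v' / f₂) f₁ = 1 := by
    rw [character_intCast_ne_zero_iff, Int.neg_gcd]
  refine ⟨?_, fun hg ↦ ?_⟩
  · have := tsum_character_mul_character_ne_zero hk hpar'
    rw [hU, ← hχ]
    -- Every factor other than `χ₁(-v'/f₂)` is non-zero: `δ` is prime to `f₂` by the determinant,
    -- and `M'` because it is prime to `v'`, a multiple of `f₂`.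
    simp [hM0, hδ, hM'χ, this, eisensteinScale_ne_zero k hχ₂]
  · have hform : Upsilon k χ₁ χ₂ γ M =
        -χ₂ (δ : ZMod f₂) * χ₂⁻¹ (M' : ZMod f₂) * χ₁ ((-(v' / f₂) : ℤ) : ZMod f₁) *
        ((f₂ : ℂ) / ((M' : ℂ) * ((χ₁⁻¹.primitive_mul χ₂).conductor : ℂ))) ^ k *
        (gaussW (χ₁.primitive_mul χ₂⁻¹) / gaussW χ₂⁻¹) *
        (genBernoulli (χ₁⁻¹.primitive_mul χ₂) k / (2 * (k : ℂ))) *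
        ∏ p ∈ (f₁ * f₂).primeFactors,
          (1 - χ₁.primitive_mul χ₂⁻¹ (p : ZMod _) * ((p : ℂ) ^ k)⁻¹) := by
      rw [hU, mul_left_comm _ (_ * _) (tsum _), eisensteinScale_inv_mul_tsum hk hparity]
      simp only [div_eq_mul_inv, mul_inv, mul_pow, inv_pow]
      ring
    rw [MulChar.star_eq_inv, MulChar.star_eq_inv]
    refine ⟨_, rfl, ?_, ?_, hform⟩
    · rw [← isOfFinOrder_iff_pow_eq_one]
      have hneg : IsOfFinOrder (-1 : ℂ) := isOfFinOrder_iff_pow_eq_one.mpr ⟨2, two_pos, by norm_num⟩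
      rw [neg_eq_neg_one_mul]
      exact ((hneg.mul (isOfFinOrder_character χ₂ hδ)).mul
        (isOfFinOrder_character χ₂⁻¹ hM'χ)).mul (isOfFinOrder_character χ₁ (hχ.mpr hg))
    · rw [hform]
      have hnat (n : ℕ) : IsAlgebraic ℚ (n : ℂ) := isAlgebraic_natCast n
      refine ((((((isAlgebraic_character _ _).neg.mul (isAlgebraic_character _ _)).mul
        (isAlgebraic_character _ _)).mul (IsAlgebraic.pow ?_ k)).mul ?_).mul ?_).mul
        (isAlgebraic_prod _ fun p _ ↦ isAlgebraic_one.sub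
          ((isAlgebraic_character _ _).mul ((hnat p).pow k).inv))
      · exact (hnat _).mul ((hnat _).mul (hnat _)).inv
      · exact (isAlgebraic_gaussW _).mul (isAlgebraic_gaussW _).inv
      · exact (isAlgebraic_genBernoulli _ _).mul
          ((hnat 2).mul (hnat k)).inv
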